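/- Theorem 1.3. Let $m:(0,\infty)\to[0,\infty)$ be smooth and non-increasing with $\lim_{r\to0+}m(r)=\infty$. Suppose that there are $C_0,r_0>0$ with $r\,m(r)\le C_0$ for all $r\in(0,r_0)$, that $r^{\alpha}m(r)$ is non-increasing on $(0,\infty)$ for some $\alpha>0$, that $r|m'(r)|\le C\,m(r)$ for all $r>0$ and some constant $C\ge 1$, and that $$\lim_{\varepsilon\to0+}\int_{\varepsilon}^{1}m(r)\,dr<\infty .$$ Let $$\mathcal L f(x)=\mathrm{P.V.}\int_{\mathbb R}\big(f(x)-f(x+y)\big)\frac{m(|y|)}{|y|}\,dy .$$ Then for every period length $\ell>0$ there exist a $C^\infty$, $\ell$-periodic initial datum $\theta_0:\mathbb R\to\mathbb R$, a finite time $T>0$, and a function $\theta=\theta(x,t)$ that is $C^\infty$ on $\mathbb R\times[0,T)$ and $\ell$-periodic in $x$, such that $$\partial_t\theta-\theta\,\theta_x+\mathcal L\theta=0\quad\text{on }\mathbb R\times[0,T),\qquad \theta(\cdot,0)=\theta_0,$$ and $$\lim_{t\to T-}\|\theta_x(\cdot,t)\|_{L^\infty}=\infty .$$ -/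

import Mathlib

open Set Filter Topology MeasureTheory
open scoped ContDiff

/-- The standing assumptions on the radial profile `m : (0,∞) → [0,∞)` of the dissipation.
Only the values of `m` on `(0,∞)` matter. -/
structure IsDissipationProfile (m : ℝ → ℝ) : Prop where
  /-- `m` is smooth on `(0,∞)`. -/
  smooth : ContDiffOn ℝ ∞ m (Ioi 0)
  /-- `m` takes values in `[0,∞)`. -/
  nonneg : ∀ r : ℝ, 0 < r → 0 ≤ m r
  /-- `m` is non-increasing. -/
  antitone : AntitoneOn m (Ioi 0)
  /-- `m` is singular at the origin. -/
  singular : Tendsto m (𝓝[>] 0) atTop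
  /-- `r m(r)` is bounded near the origin. -/
  critical : ∃ C₀ r₀ : ℝ, 0 < C₀ ∧ 0 < r₀ ∧ ∀ r ∈ Ioo 0 r₀, r * m r ≤ C₀
  /-- `r ^ α m(r)` is non-increasing for some `α > 0`. -/
  decay : ∃ α : ℝ, 0 < α ∧ AntitoneOn (fun r : ℝ => r ^ α * m r) (Ioi 0)

/-- `HasDissipation m f x l` says that the principal value integral
`P.V. ∫ (f(x) - f(x+y)) m(|y|)/|y| dy` over the real line exists and equals `l`, that is,
`(ℒ f)(x) = l`. -/
def HasDissipation (m f : ℝ → ℝ) (x l : ℝ) : Prop :=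
  (∀ ε : ℝ, 0 < ε →
    IntegrableOn (fun y : ℝ => (f x - f (x + y)) * (m |y| / |y|)) {y : ℝ | ε < |y|}) ∧
  Tendsto (fun ε : ℝ => ∫ y in {y : ℝ | ε < |y|}, (f x - f (x + y)) * (m |y| / |y|))
    (𝓝[>] 0) (𝓝 l)

/-- `θ t x` is a smooth, spatially `ℓ`-periodic solution on the time interval `[0,T)` of
`∂ₜθ - θ θₓ + ℒθ = 0` with initial datum `θ₀`. Smoothness is joint in `(t,x)` and up to the initial
time; at `t = 0` the time derivative is one-sided. -/
structure IsSmoothBurgersSolution (m : ℝ → ℝ) (ℓ T : ℝ) (θ₀ : ℝ → ℝ) (θ : ℝ → ℝ → ℝ) : Prop where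
  smooth : ContDiffOn ℝ ∞ (fun p : ℝ × ℝ => θ p.1 p.2) (Ico 0 T ×ˢ univ)
  periodic : ∀ t ∈ Ico 0 T, Function.Periodic (θ t) ℓ
  initial : ∀ x : ℝ, θ 0 x = θ₀ x
  equation : ∀ t ∈ Ico 0 T, ∀ x : ℝ, ∃ θt Lθ : ℝ,
    HasDerivWithinAt (fun s : ℝ => θ s x) θt (Ico 0 T) t ∧
    HasDissipation m (θ t) x Lθ ∧
    θt - θ t x * deriv (θ t) x + Lθ = 0

/-! ### Lévy kernels of order at most one -/

/-! Write g(y) = m(|y|)/|y|. Integrability of m near 0 and the decay of r^α m(r) at infinity give ∫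
min(1,|y|) g(y) dy < ∞ (`IsDissipationProfile.levyKernel`). Hence ℒ has order at most one: its
integral converges absolutely on bounded Lipschitz functions, and it is too weak to stop a Burgers
shock.

Breakdown is forced by the moment I(t) = ∫₀^ℓ θ(x,t)(ℓ/2 - x) dx. For odd, ℓ-periodic θ with |θ| ≤
K, the transport term contributes ½∫θ², which by Cauchy–Schwarz is at least I²/(2W) with W = ℓ³/12.
Integration by parts against the sawtooth turns the dissipative term into ℓ∫ P(y) g(y) dy, P being
the primitive of θ, and this is at most a constant times K (`integral_sub_translate_mul`,
`abs_integral_Lop_mul_le`). The maximum principle keeps K fixed in time. The gain is quadratic in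
the amplitude of the datum and the loss is linear, so for a large sine wave I(t) stays above I(0) +
t, while |I| ≤ Kℓ². Regularity therefore cannot persist beyond time Kℓ²
(`OddDatum.le_of_slopeControlled`).

The solution comes from an explicit monotone difference scheme. Each step is an average, so the
scheme and its differentiated versions obey a discrete maximum principle
(`CFL.abs_add_discreteRate_le`), and a bound on the discrete slopes bounds every derivative
uniformly in the mesh (`exists_bound_scheme`). Limits are taken along one fixed ultrafilter, so all
times and all derivatives converge together, and neither subsequences nor a uniqueness theorem are
needed. A slope bound B for the limit at time t prolongs the control of the discrete slopes by
1/(16(B+1)) (`OddDatum.slopeControlled_add`). Let S be the supremum of the controlled times. It is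
finite, so the slope must tend to infinity at S. The equation converts smoothness in space into
joint smoothness on (0,S), and the solution restarted at time S/2 is the one required. -/

/-- An even nonnegative kernel that integrates `min 1 |y|`. -/
structure LevyKernel (g : ℝ → ℝ) : Prop where
  nonneg : ∀ y, 0 ≤ g y
  even : ∀ y, g (-y) = g y
  meas : AEStronglyMeasurable g volume
  int : Integrable (fun y => min 1 |y| * g y)

/-- The nonlocal operator with kernel `g`. -/
noncomputable def Lop (g f : ℝ → ℝ) (x : ℝ) : ℝ := ∫ y, (f x - f (x + y)) * g y

/-- The total mass of a kernel against `min 1 |y|`. -/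
noncomputable def kernelMass (g : ℝ → ℝ) : ℝ := ∫ y, min 1 |y| * g y

/-- Smooth functions all of whose derivatives are bounded. -/
structure SmoothBdd (f : ℝ → ℝ) : Prop where
  smooth : ContDiff ℝ ∞ f
  bdd : ∀ k, ∃ B, ∀ x, |iteratedDeriv k f x| ≤ B

lemma abs_sub_le_of_hasDerivAt {u u' : ℝ → ℝ} {B : ℝ} (h : ∀ x, HasDerivAt u (u' x) x)
    (hb : ∀ x, |u' x| ≤ B) (x y : ℝ) : |u x - u y| ≤ B * |x - y| := by
  have := convex_univ.norm_image_sub_le_of_norm_hasDerivWithin_le (f := u) (f' := u') (C := B)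
    (x := y) (y := x) (fun z _ => (h z).hasDerivWithinAt) (fun z _ => hb z) (mem_univ _)
    (mem_univ _)
  simpa [Real.norm_eq_abs] using this

lemma abs_sub_add_le_min {f : ℝ → ℝ} {B₀ B₁ : ℝ} (h0 : ∀ x, |f x| ≤ B₀)
    (h1 : ∀ x y, |f x - f y| ≤ B₁ * |x - y|) (x y : ℝ) :
    |f x - f (x + y)| ≤ (2 * B₀ + B₁) * min 1 |y| := by
  have hB0 : 0 ≤ B₀ := (abs_nonneg _).trans (h0 0)
  have hB1 : 0 ≤ B₁ := by
    have := (abs_nonneg _).trans (h1 1 0)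
    simpa using this
  have a1 : |f x - f (x + y)| ≤ 2 * B₀ := by
    have := abs_sub (f x) (f (x + y))
    linarith [h0 x, h0 (x + y)]
  have a2 : |f x - f (x + y)| ≤ B₁ * |y| := by
    have := h1 x (x + y)
    simpa using this
  rcases le_total 1 |y| with h | h
  · rw [min_eq_left h]; linarith
  · rw [min_eq_right h]; nlinarith [abs_nonneg y]

namespace LevyKernel

variable {g : ℝ → ℝ} (hg : LevyKernel g)
include hg

lemma kernelMass_nonneg : 0 ≤ kernelMass g :=
  integral_nonneg fun y => mul_nonneg (le_min zero_le_one (abs_nonneg y)) (hg.nonneg y)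

lemma integrable {f : ℝ → ℝ} {B₀ B₁ : ℝ} (hf : Continuous f) (h0 : ∀ x, |f x| ≤ B₀)
    (h1 : ∀ x y, |f x - f y| ≤ B₁ * |x - y|) (x : ℝ) :
    Integrable (fun y => (f x - f (x + y)) * g y) := by
  refine (hg.int.const_mul (2 * B₀ + B₁)).mono' ?_ (ae_of_all _ fun y => ?_)
  · exact (Continuous.aestronglyMeasurable (by fun_prop)).mul hg.meas
  · rw [Real.norm_eq_abs, abs_mul, abs_of_nonneg (hg.nonneg y), ← mul_assoc]
    exact mul_le_mul_of_nonneg_right (abs_sub_add_le_min h0 h1 x y) (hg.nonneg y)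

lemma abs_Lop_le {f : ℝ → ℝ} {B₀ B₁ : ℝ} (h0 : ∀ x, |f x| ≤ B₀)
    (h1 : ∀ x y, |f x - f y| ≤ B₁ * |x - y|) (x : ℝ) :
    |Lop g f x| ≤ (2 * B₀ + B₁) * kernelMass g := by
  rw [Lop, kernelMass, ← integral_const_mul, ← Real.norm_eq_abs]
  refine norm_integral_le_of_norm_le (hg.int.const_mul _) (ae_of_all _ fun y => ?_)
  rw [Real.norm_eq_abs, abs_mul, abs_of_nonneg (hg.nonneg y), ← mul_assoc]
  exact mul_le_mul_of_nonneg_right (abs_sub_add_le_min h0 h1 x y) (hg.nonneg y)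

end LevyKernel

namespace SmoothBdd

variable {f w : ℝ → ℝ}

lemma continuous (hf : SmoothBdd f) : Continuous f := hf.smooth.continuous

lemma smooth_iteratedDeriv (hf : SmoothBdd f) (k : ℕ) : ContDiff ℝ ∞ (iteratedDeriv k f) := by
  induction k with
  | zero => simpa using hf.smooth
  | succ k ih =>
    rw [iteratedDeriv_succ]
    exact (contDiff_infty_iff_deriv.1 ih).2

lemma hasDerivAt_iteratedDeriv (hf : SmoothBdd f) (k : ℕ) (x : ℝ) :
    HasDerivAt (iteratedDeriv k f) (iteratedDeriv (k + 1) f x) x := by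
  rw [iteratedDeriv_succ]
  exact ((hf.smooth_iteratedDeriv k).differentiable (by simp) x).hasDerivAt

lemma hasDerivAt (hf : SmoothBdd f) (x : ℝ) : HasDerivAt f (deriv f x) x :=
  (hf.smooth.differentiable (by simp) x).hasDerivAt

lemma iteratedDeriv (hf : SmoothBdd f) (k : ℕ) : SmoothBdd (iteratedDeriv k f) where
  smooth := hf.smooth_iteratedDeriv k
  bdd j := by
    obtain ⟨B, hB⟩ := hf.bdd (j + k)
    refine ⟨B, fun x => ?_⟩
    have : _root_.iteratedDeriv j (_root_.iteratedDeriv k f) = _root_.iteratedDeriv (j + k) f := by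
      simp only [iteratedDeriv_eq_iterate, Function.iterate_add_apply]
    rw [this]; exact hB x

lemma deriv (hf : SmoothBdd f) : SmoothBdd (deriv f) := by
  have := hf.iteratedDeriv 1
  rwa [iteratedDeriv_one] at this

lemma bdd_zero (hf : SmoothBdd f) : ∃ B, ∀ x, |f x| ≤ B := by simpa using hf.bdd 0

lemma lipschitz (hf : SmoothBdd f) : ∃ B, ∀ x y, |f x - f y| ≤ B * |x - y| := by
  obtain ⟨B, hB⟩ := hf.deriv.bdd_zero
  exact ⟨B, abs_sub_le_of_hasDerivAt hf.hasDerivAt hB⟩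

lemma add (hf : SmoothBdd f) (hw : SmoothBdd w) : SmoothBdd (fun x => f x + w x) where
  smooth := hf.smooth.add hw.smooth
  bdd k := by
    obtain ⟨B, hB⟩ := hf.bdd k
    obtain ⟨D, hD⟩ := hw.bdd k
    refine ⟨B + D, fun x => ?_⟩
    have := iteratedDeriv_add (n := k) (x := x) (f := f) (g := w)
      (hf.smooth.contDiffAt.of_le (by exact_mod_cast le_top))
      (hw.smooth.contDiffAt.of_le (by exact_mod_cast le_top))
    change |_root_.iteratedDeriv k (f + w) x| ≤ _
    rw [this]
    exact (abs_add_le _ _).trans (add_le_add (hB x) (hD x))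

lemma const_mul (c : ℝ) (hf : SmoothBdd f) : SmoothBdd (fun x => c * f x) where
  smooth := contDiff_const.mul hf.smooth
  bdd k := by
    obtain ⟨B, hB⟩ := hf.bdd k
    refine ⟨|c| * B, fun x => ?_⟩
    rw [iteratedDeriv_const_mul_field, abs_mul]
    exact mul_le_mul_of_nonneg_left (hB x) (abs_nonneg c)

lemma sub (hf : SmoothBdd f) (hw : SmoothBdd w) : SmoothBdd (fun x => f x - w x) := by
  simpa [sub_eq_add_neg] using hf.add (hw.const_mul (-1))

lemma comp_add (hf : SmoothBdd f) (h : ℝ) : SmoothBdd (fun x => f (x + h)) where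
  smooth := hf.smooth.comp (contDiff_id.add contDiff_const)
  bdd k := by
    obtain ⟨B, hB⟩ := hf.bdd k
    refine ⟨B, fun x => ?_⟩
    rw [iteratedDeriv_comp_add_const]
    exact hB _

lemma iteratedDeriv_mul (hf : SmoothBdd f) (hw : SmoothBdd w) (k : ℕ) (x : ℝ) :
    _root_.iteratedDeriv k (fun x => f x * w x) x =
      ∑ i ∈ Finset.range (k + 1), (k.choose i : ℝ) * _root_.iteratedDeriv i f x *
        _root_.iteratedDeriv (k - i) w x :=
  _root_.iteratedDeriv_mul (hf.smooth.contDiffAt.of_le (by exact_mod_cast le_top))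
      (hw.smooth.contDiffAt.of_le (by exact_mod_cast le_top))

lemma mul (hf : SmoothBdd f) (hw : SmoothBdd w) : SmoothBdd (fun x => f x * w x) where
  smooth := hf.smooth.mul hw.smooth
  bdd k := by
    choose B hB using hf.bdd
    choose D hD using hw.bdd
    refine ⟨∑ i ∈ Finset.range (k + 1), (k.choose i : ℝ) * B i * D (k - i), fun x => ?_⟩
    rw [iteratedDeriv_mul hf hw]
    refine (Finset.abs_sum_le_sum_abs _ _).trans (Finset.sum_le_sum fun i _ => ?_)
    rw [abs_mul, abs_mul, Nat.abs_cast]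
    have := (abs_nonneg _).trans (hB i x)
    gcongr
    · exact hB i x
    · exact hD _ x

/-- Differentiation under the integral, with a multiple of `min 1 |y| * g y` as majorant. Since ℒ
commutes with d/dx, every bound for ℒ f carries over to its derivatives. -/
lemma hasDerivAt_Lop {g : ℝ → ℝ} (hg : LevyKernel g) (hf : SmoothBdd f) (x : ℝ) :
    HasDerivAt (Lop g f) (Lop g (_root_.deriv f) x) x := by
  obtain ⟨B₀, h0⟩ := hf.bdd_zero
  obtain ⟨B₁, h1⟩ := hf.lipschitz
  obtain ⟨D₀, d0⟩ := hf.deriv.bdd_zero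
  obtain ⟨D₁, d1⟩ := hf.deriv.lipschitz
  have c0 := hf.continuous
  have c1 := hf.deriv.continuous
  refine (hasDerivAt_integral_of_dominated_loc_of_deriv_le
    (F := fun x y => (f x - f (x + y)) * g y)
    (F' := fun x y => (_root_.deriv f x - _root_.deriv f (x + y)) * g y)
    (bound := fun y => (2 * D₀ + D₁) * (min 1 |y| * g y))
    (s := univ) univ_mem (Eventually.of_forall fun z => (hg.integrable c0 h0 h1 z).1)
    (hg.integrable c0 h0 h1 x) (hg.integrable c1 d0 d1 x).1
    (ae_of_all _ fun y z _ => ?_) (hg.int.const_mul _) (ae_of_all _ fun y z _ => ?_)).2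
  · rw [Real.norm_eq_abs, abs_mul, abs_of_nonneg (hg.nonneg y), ← mul_assoc]
    exact mul_le_mul_of_nonneg_right (abs_sub_add_le_min d0 d1 z y) (hg.nonneg y)
  · exact ((hf.hasDerivAt z).sub ((hf.hasDerivAt (z + y)).comp_add_const z y)).mul_const (g y)

lemma iteratedDeriv_Lop {g : ℝ → ℝ} (hg : LevyKernel g) (hf : SmoothBdd f) (k : ℕ) :
    _root_.iteratedDeriv k (Lop g f) = Lop g (_root_.iteratedDeriv k f) := by
  induction k with
  | zero => simp
  | succ k ih =>
    rw [iteratedDeriv_succ, ih, iteratedDeriv_succ]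
    exact funext fun x => ((hf.iteratedDeriv k).hasDerivAt_Lop hg x).deriv

lemma Lop {g : ℝ → ℝ} (hg : LevyKernel g) (hf : SmoothBdd f) : SmoothBdd (Lop g f) where
  smooth := by
    refine contDiff_of_differentiable_iteratedDeriv fun k _ => ?_
    rw [hf.iteratedDeriv_Lop hg]
    exact fun x => ((hf.iteratedDeriv k).hasDerivAt_Lop hg x).differentiableAt
  bdd k := by
    rw [hf.iteratedDeriv_Lop hg]
    obtain ⟨B₀, h0⟩ := (hf.iteratedDeriv k).bdd_zero
    obtain ⟨B₁, h1⟩ := (hf.iteratedDeriv k).lipschitz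
    exact ⟨_, hg.abs_Lop_le h0 h1⟩

end SmoothBdd

/-! ### Truncated kernels -/

/-- The kernel with the ball of radius `h` removed. -/
noncomputable def truncKernel (g : ℝ → ℝ) (h : ℝ) : ℝ → ℝ := {y : ℝ | h < |y|}.indicator g

/-- The modulus `∫ min |e| |y| g(y) dy`. -/
noncomputable def kernelModulus (g : ℝ → ℝ) (e : ℝ) : ℝ := ∫ y, min |e| |y| * g y

lemma measurableSet_lt_abs (h : ℝ) : MeasurableSet {y : ℝ | h < |y|} :=
  (isOpen_lt continuous_const continuous_abs).measurableSet

namespace LevyKernel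

variable {g : ℝ → ℝ} (hg : LevyKernel g)
include hg

lemma truncKernel_nonneg (h y : ℝ) : 0 ≤ truncKernel g h y :=
  indicator_nonneg (fun y _ => hg.nonneg y) y

lemma truncKernel_le (h y : ℝ) : truncKernel g h y ≤ g y :=
  indicator_le_self' (fun y _ => hg.nonneg y) y

lemma trunc (h : ℝ) : LevyKernel (truncKernel g h) where
  nonneg := hg.truncKernel_nonneg h
  even y := by simp [truncKernel, indicator, hg.even y]
  meas := hg.meas.indicator (measurableSet_lt_abs h)
  int := by
    refine hg.int.mono' ?_ (ae_of_all _ fun y => ?_)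
    · exact (Continuous.aestronglyMeasurable (by fun_prop)).mul
        (hg.meas.indicator (measurableSet_lt_abs h))
    · have : 0 ≤ min 1 |y| := le_min zero_le_one (abs_nonneg y)
      rw [Real.norm_eq_abs, abs_of_nonneg (mul_nonneg this (hg.truncKernel_nonneg h y))]
      exact mul_le_mul_of_nonneg_left (hg.truncKernel_le h y) this

lemma integrable_trunc {h : ℝ} (hh : 0 < h) : Integrable (truncKernel g h) := by
  refine (hg.int.const_mul (min 1 h)⁻¹).mono' (hg.trunc h).meas (ae_of_all _ fun y => ?_)
  have hm : 0 < min 1 h := lt_min one_pos hh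
  rw [Real.norm_eq_abs, abs_of_nonneg (hg.truncKernel_nonneg h y)]
  by_cases hy : h < |y|
  · have h1 : truncKernel g h y = g y := indicator_of_mem (s := {y : ℝ | h < |y|}) hy g
    rw [h1, ← mul_assoc]
    refine le_mul_of_one_le_left (hg.nonneg y) ?_
    rw [inv_mul_eq_div, one_le_div hm]
    exact min_le_min_left 1 hy.le
  · have h1 : truncKernel g h y = 0 := indicator_of_notMem (s := {y : ℝ | h < |y|}) hy g
    rw [h1]
    exact mul_nonneg (inv_nonneg.2 hm.le)
      (mul_nonneg (le_min zero_le_one (abs_nonneg y)) (hg.nonneg y))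

lemma kernelMass_trunc_le (h : ℝ) : kernelMass (truncKernel g h) ≤ kernelMass g :=
  integral_mono (hg.trunc h).int hg.int fun y =>
    mul_le_mul_of_nonneg_left (hg.truncKernel_le h y) (le_min zero_le_one (abs_nonneg y))

lemma integrable_modulus (e : ℝ) : Integrable (fun y => min |e| |y| * g y) := by
  refine (hg.int.const_mul (max 1 |e|)).mono' ?_ (ae_of_all _ fun y => ?_)
  · exact (Continuous.aestronglyMeasurable (by fun_prop)).mul hg.meas
  · rw [Real.norm_eq_abs, abs_mul, abs_of_nonneg (hg.nonneg y), ← mul_assoc,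
      abs_of_nonneg (le_min (abs_nonneg e) (abs_nonneg y))]
    refine mul_le_mul_of_nonneg_right ?_ (hg.nonneg y)
    rcases le_total 1 |y| with h | h
    · rw [min_eq_left h, mul_one]; exact (min_le_left _ _).trans (le_max_right _ _)
    · rw [min_eq_right h]
      exact (min_le_right _ _).trans (le_mul_of_one_le_left (abs_nonneg y) (le_max_left _ _))

lemma tendsto_modulus : Tendsto (kernelModulus g) (𝓝 0) (𝓝 0) := by
  have : Tendsto (kernelModulus g) (𝓝 0) (𝓝 (∫ _ : ℝ, (0 : ℝ))) := by
    refine tendsto_integral_filter_of_dominated_convergence (fun y => min 1 |y| * g y)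
      (Eventually.of_forall fun e => (hg.integrable_modulus e).1) ?_ hg.int (ae_of_all _ fun y => ?_)
    · filter_upwards [Metric.closedBall_mem_nhds (0 : ℝ) one_pos] with e he
      refine ae_of_all _ fun y => ?_
      rw [Real.norm_eq_abs, abs_mul, abs_of_nonneg (hg.nonneg y),
        abs_of_nonneg (le_min (abs_nonneg e) (abs_nonneg y))]
      refine mul_le_mul_of_nonneg_right (min_le_min_right _ ?_) (hg.nonneg y)
      simpa using he
    · have : Continuous fun e : ℝ => min |e| |y| * g y := by fun_prop
      simpa using this.tendsto 0
  simpa using this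

/-- For |y| > h the increments of f - p are at most both 2e and 2B|y|. For |y| ≤ h only p
contributes, with increment at most B|y|. Both moduli vanish in the limit by `tendsto_modulus`, so
uniform closeness together with a common Lipschitz constant suffices for convergence of the
truncated operators. -/
lemma abs_Lop_trunc_sub_le {f p : ℝ → ℝ} {A B e h : ℝ} (he : 0 ≤ e) (hh : 0 ≤ h)
    (cf : Continuous f) (cp : Continuous p) (hf0 : ∀ x, |f x| ≤ A) (hp0 : ∀ x, |p x| ≤ A)
    (hf : ∀ x y, |f x - f y| ≤ B * |x - y|) (hp : ∀ x y, |p x - p y| ≤ B * |x - y|)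
    (hfp : ∀ x, |f x - p x| ≤ e) (x : ℝ) :
    |Lop (truncKernel g h) f x - Lop g p x| ≤
      (2 + 2 * B) * kernelModulus g e + B * kernelModulus g h := by
  have hB : 0 ≤ B := by
    have := (abs_nonneg _).trans (hf 1 0)
    simpa using this
  rw [Lop, Lop, ← integral_sub ((hg.trunc h).integrable cf hf0 hf x) (hg.integrable cp hp0 hp x),
    kernelModulus, kernelModulus, ← integral_const_mul, ← integral_const_mul,
    ← integral_add ((hg.integrable_modulus e).const_mul _)
      ((hg.integrable_modulus h).const_mul _), ← Real.norm_eq_abs]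
  refine norm_integral_le_of_norm_le (((hg.integrable_modulus e).const_mul _).add
      ((hg.integrable_modulus h).const_mul _)) (ae_of_all _ fun y => ?_)
  have me : 0 ≤ min |e| |y| := le_min (abs_nonneg e) (abs_nonneg y)
  have mh : 0 ≤ min |h| |y| := le_min (abs_nonneg h) (abs_nonneg y)
  have gy := hg.nonneg y
  rw [Real.norm_eq_abs]
  have p1 : |p x - p (x + y)| ≤ B * |y| := by simpa using hp x (x + y)
  have f1 : |f x - f (x + y)| ≤ B * |y| := by simpa using hf x (x + y)
  by_cases hy : h < |y|
  · have h1 : truncKernel g h y = g y := indicator_of_mem (s := {y : ℝ | h < |y|}) hy g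
    rw [h1, ← sub_mul, abs_mul, abs_of_nonneg gy]
    have a1 : |f x - f (x + y) - (p x - p (x + y))| ≤ (2 + 2 * B) * min |e| |y| := by
      rw [abs_of_nonneg he]
      rcases le_total e |y| with h | h
      · rw [min_eq_left h]
        have : f x - f (x + y) - (p x - p (x + y)) = (f x - p x) - (f (x + y) - p (x + y)) := by
          ring
        rw [this]
        have := abs_sub (f x - p x) (f (x + y) - p (x + y))
        nlinarith [hfp x, hfp (x + y)]
      · rw [min_eq_right h]
        have := abs_sub (f x - f (x + y)) (p x - p (x + y))
        nlinarith [abs_nonneg y]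
    calc _ ≤ (2 + 2 * B) * min |e| |y| * g y := mul_le_mul_of_nonneg_right a1 gy
      _ ≤ _ := by nlinarith [mul_nonneg hB (mul_nonneg mh gy)]
  · have h1 : truncKernel g h y = 0 := indicator_of_notMem (s := {y : ℝ | h < |y|}) hy g
    rw [h1, mul_zero, zero_sub, abs_neg, abs_mul, abs_of_nonneg gy]
    have a1 : |p x - p (x + y)| ≤ B * min |h| |y| := by
      rw [abs_of_nonneg hh, min_eq_right (not_lt.1 hy)]; exact p1
    calc _ ≤ B * min |h| |y| * g y := mul_le_mul_of_nonneg_right a1 gy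
      _ ≤ _ := by nlinarith [mul_nonneg hB (mul_nonneg me gy), mul_nonneg me gy]

end LevyKernel

/-! ### A monotone difference scheme -/

/-- The centred difference quotient. -/
noncomputable def centralDiff (h : ℝ) (u : ℝ → ℝ) (x : ℝ) : ℝ := (2 * h)⁻¹ * (u (x + h) - u (x + -h))

/-- The numerical viscosity. -/
noncomputable def numVisc (K h : ℝ) (u : ℝ → ℝ) (x : ℝ) : ℝ :=
  K * (2 * h)⁻¹ * (u (x + h) + u (x + -h) - 2 * u x)

/-- The discretized right-hand side `a uₓ - ℒ u` of the transport equation with velocity `a`. -/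
noncomputable def discreteRate (g : ℝ → ℝ) (K h : ℝ) (a u : ℝ → ℝ) (x : ℝ) : ℝ :=
  a x * centralDiff h u x + numVisc K h u x - Lop (truncKernel g h) u x

/-- One explicit time step. -/
noncomputable def eulerStep (g : ℝ → ℝ) (K h δ : ℝ) (f : ℝ → ℝ) (x : ℝ) : ℝ :=
  f x + δ * discreteRate g K h f f x

/-- The iterates of the scheme. -/
noncomputable def scheme (g : ℝ → ℝ) (K h δ : ℝ) (f : ℝ → ℝ) (n : ℕ) : ℝ → ℝ :=
  (eulerStep g K h δ)^[n] f

/-- The step-size restriction making the scheme monotone. -/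
structure CFL (g : ℝ → ℝ) (K h δ : ℝ) : Prop where
  levy : LevyKernel g
  K_nonneg : 0 ≤ K
  h_pos : 0 < h
  δ_pos : 0 < δ
  le_one : δ * (K * h⁻¹ + ∫ y, truncKernel g h y) ≤ 1

section bounds

variable {u : ℝ → ℝ} {B h : ℝ}

lemma abs_centralDiff_le (hh : 0 < h) (hu : ∀ x y, |u x - u y| ≤ B * |x - y|) (x : ℝ) :
    |centralDiff h u x| ≤ B := by
  have := hu (x + h) (x + -h)
  rw [centralDiff, abs_mul, abs_of_pos (by positivity), inv_mul_le_iff₀ (by positivity)]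
  refine this.trans (le_of_eq ?_)
  rw [show x + h - (x + -h) = 2 * h by ring, abs_of_pos (by positivity)]; ring

lemma abs_numVisc_le {K : ℝ} (hK : 0 ≤ K) (hh : 0 < h) (hu : ∀ x y, |u x - u y| ≤ B * |x - y|)
    (x : ℝ) : |numVisc K h u x| ≤ K * B := by
  have h1 := hu (x + h) x
  have h2 := hu (x + -h) x
  simp only [add_sub_cancel_left, abs_neg, abs_of_pos hh] at h1 h2
  rw [numVisc, mul_assoc, abs_mul, abs_of_nonneg hK]
  refine mul_le_mul_of_nonneg_left ?_ hK
  rw [abs_mul, abs_of_pos (by positivity), inv_mul_le_iff₀ (by positivity)]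
  have := abs_add_le (u (x + h) - u x) (u (x + -h) - u x)
  rw [show u (x + h) + u (x + -h) - 2 * u x = u (x + h) - u x + (u (x + -h) - u x) by ring]
  linarith

/-- The viscosity is a second difference divided by h, not by h², so a Lipschitz bound on `u`
controls every term uniformly in `h`. -/
lemma abs_discreteRate_le {g a : ℝ → ℝ} (hg : LevyKernel g) {K A B₀ : ℝ} (hK : 0 ≤ K) (hh : 0 < h)
    (ha : ∀ x, |a x| ≤ A) (h0 : ∀ x, |u x| ≤ B₀) (hu : ∀ x y, |u x - u y| ≤ B * |x - y|)
    (x : ℝ) : |discreteRate g K h a u x| ≤ A * B + K * B + (2 * B₀ + B) * kernelMass g := by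
  have hB : 0 ≤ B := by
    have := (abs_nonneg _).trans (hu 1 0)
    simpa using this
  have hB0 : 0 ≤ B₀ := (abs_nonneg _).trans (h0 0)
  have a1 : |a x * centralDiff h u x| ≤ A * B := by
    rw [abs_mul]
    exact mul_le_mul (ha x) (abs_centralDiff_le hh hu x) (abs_nonneg _) ((abs_nonneg _).trans (ha x))
  have a2 := abs_numVisc_le hK hh hu x
  have a3 := ((hg.trunc h).abs_Lop_le h0 hu x).trans
    (mul_le_mul_of_nonneg_left (hg.kernelMass_trunc_le h) (by positivity))
  rw [discreteRate]
  have b1 := abs_sub (a x * centralDiff h u x + numVisc K h u x) (Lop (truncKernel g h) u x)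
  have b2 := abs_add_le (a x * centralDiff h u x) (numVisc K h u x)
  linarith

end bounds

namespace CFL

variable {g : ℝ → ℝ} {K h δ : ℝ} (hc : CFL g K h δ)
include hc

/-- The discrete maximum principle. -/
lemma abs_add_discreteRate_le {a u : ℝ → ℝ} {M : ℝ} (cu : Continuous u) (ha : ∀ x, |a x| ≤ K)
    (hu : ∀ x, |u x| ≤ M) (x : ℝ) : |u x + δ * discreteRate g K h a u x| ≤ M := by
  have hg := hc.levy
  have hh := hc.h_pos
  have hδ := hc.δ_pos
  set G := truncKernel g h with hG
  have iG : Integrable G := hg.integrable_trunc hh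
  have iu : Integrable (fun y => u (x + y) * G y) := by
    refine (iG.const_mul M).mono' ((Continuous.aestronglyMeasurable (by fun_prop)).mul iG.1)
      (ae_of_all _ fun y => ?_)
    rw [Real.norm_eq_abs, abs_mul, abs_of_nonneg (hg.truncKernel_nonneg h y)]
    exact mul_le_mul_of_nonneg_right (hu _) (hg.truncKernel_nonneg h y)
  have hL : Lop G u x = u x * (∫ y, G y) - ∫ y, u (x + y) * G y := by
    rw [Lop, ← integral_const_mul, ← integral_sub (iG.const_mul _) iu]
    simp only [sub_mul]
  have hI : |∫ y, u (x + y) * G y| ≤ M * ∫ y, G y := by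
    rw [← integral_const_mul, ← Real.norm_eq_abs]
    refine norm_integral_le_of_norm_le (iG.const_mul _) (ae_of_all _ fun y => ?_)
    rw [Real.norm_eq_abs, abs_mul, abs_of_nonneg (hg.truncKernel_nonneg h y)]
    exact mul_le_mul_of_nonneg_right (hu _) (hg.truncKernel_nonneg h y)
  set lam := ∫ y, G y with hlam
  set I := ∫ y, u (x + y) * G y with hIdef
  have hM : 0 ≤ M := (abs_nonneg _).trans (hu x)
  have hax := abs_le.1 (ha x)
  -- The step is a weighted average of values of `u`. The weights are nonnegative because the
  -- viscosity K dominates the velocity and because of the step-size restriction; `tot` says that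
  -- they sum to one.
  have key : u x + δ * discreteRate g K h a u x =
      (1 - δ * (K * h⁻¹ + lam)) * u x + δ * (2 * h)⁻¹ * (K + a x) * u (x + h)
        + δ * (2 * h)⁻¹ * (K - a x) * u (x + -h) + δ * I := by
    rw [discreteRate, centralDiff, numVisc, ← hG, hL]
    field_simp
    ring
  have c0 : 0 ≤ 1 - δ * (K * h⁻¹ + lam) := by linarith [hc.le_one]
  have c1 : 0 ≤ δ * (2 * h)⁻¹ * (K + a x) := mul_nonneg (by positivity) (by linarith)
  have c2 : 0 ≤ δ * (2 * h)⁻¹ * (K - a x) := mul_nonneg (by positivity) (by linarith)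
  have tot : (1 - δ * (K * h⁻¹ + lam)) * M + δ * (2 * h)⁻¹ * (K + a x) * M
        + δ * (2 * h)⁻¹ * (K - a x) * M + δ * (M * lam) = M := by
    field_simp
    ring
  have u0 := abs_le.1 (hu x)
  have u1 := abs_le.1 (hu (x + h))
  have u2 := abs_le.1 (hu (x + -h))
  have u3 := abs_le.1 hI
  rw [key, abs_le]
  constructor
  · rw [← tot]
    nlinarith [mul_le_mul_of_nonneg_left u0.1 c0, mul_le_mul_of_nonneg_left u1.1 c1,
      mul_le_mul_of_nonneg_left u2.1 c2, mul_le_mul_of_nonneg_left u3.1 hδ.le]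
  · nlinarith [mul_le_mul_of_nonneg_left u0.2 c0, mul_le_mul_of_nonneg_left u1.2 c1,
      mul_le_mul_of_nonneg_left u2.2 c2, mul_le_mul_of_nonneg_left u3.2 hδ.le]

end CFL

/-! ### Smoothness, periodicity and oddness along the scheme -/

namespace SmoothBdd

variable {f w : ℝ → ℝ}

lemma contDiffAt (hf : SmoothBdd f) (k : ℕ) (x : ℝ) : ContDiffAt ℝ k f x :=
  hf.smooth.contDiffAt.of_le (by exact_mod_cast le_top)

lemma iteratedDeriv_add (hf : SmoothBdd f) (hw : SmoothBdd w) (k : ℕ) (x : ℝ) :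
    _root_.iteratedDeriv k (fun x => f x + w x) x =
      _root_.iteratedDeriv k f x + _root_.iteratedDeriv k w x :=
  _root_.iteratedDeriv_add (hf.contDiffAt k x) (hw.contDiffAt k x)

lemma iteratedDeriv_sub (hf : SmoothBdd f) (hw : SmoothBdd w) (k : ℕ) (x : ℝ) :
    _root_.iteratedDeriv k (fun x => f x - w x) x =
      _root_.iteratedDeriv k f x - _root_.iteratedDeriv k w x :=
  _root_.iteratedDeriv_sub (hf.contDiffAt k x) (hw.contDiffAt k x)

lemma iteratedDeriv_comp_add (h : ℝ) (k : ℕ) (x : ℝ) :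
    _root_.iteratedDeriv k (fun x => f (x + h)) x = _root_.iteratedDeriv k f (x + h) := by
  rw [iteratedDeriv_comp_add_const]

lemma lipschitz_iteratedDeriv (hf : SmoothBdd f) {k : ℕ} {B : ℝ}
    (hB : ∀ x, |_root_.iteratedDeriv (k + 1) f x| ≤ B) (x y : ℝ) :
    |_root_.iteratedDeriv k f x - _root_.iteratedDeriv k f y| ≤ B * |x - y| :=
  abs_sub_le_of_hasDerivAt (hf.hasDerivAt_iteratedDeriv k) hB x y

lemma centralDiff (hf : SmoothBdd f) (h : ℝ) : SmoothBdd (centralDiff h f) :=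
  ((hf.comp_add h).sub (hf.comp_add (-h))).const_mul _

lemma iteratedDeriv_centralDiff (hf : SmoothBdd f) (h : ℝ) (k : ℕ) (x : ℝ) :
    _root_.iteratedDeriv k (_root_.centralDiff h f) x =
      _root_.centralDiff h (_root_.iteratedDeriv k f) x := by
  unfold _root_.centralDiff
  rw [iteratedDeriv_const_mul_field, (hf.comp_add h).iteratedDeriv_sub (hf.comp_add (-h)),
    iteratedDeriv_comp_add, iteratedDeriv_comp_add]

lemma numVisc (hf : SmoothBdd f) (K h : ℝ) : SmoothBdd (numVisc K h f) :=
  (((hf.comp_add h).add (hf.comp_add (-h))).sub (hf.const_mul 2)).const_mul _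

lemma iteratedDeriv_numVisc (hf : SmoothBdd f) (K h : ℝ) (k : ℕ) (x : ℝ) :
    _root_.iteratedDeriv k (_root_.numVisc K h f) x =
      _root_.numVisc K h (_root_.iteratedDeriv k f) x := by
  unfold _root_.numVisc
  rw [iteratedDeriv_const_mul_field,
    ((hf.comp_add h).add (hf.comp_add (-h))).iteratedDeriv_sub (hf.const_mul 2),
    (hf.comp_add h).iteratedDeriv_add (hf.comp_add (-h)),
    iteratedDeriv_comp_add, iteratedDeriv_comp_add, iteratedDeriv_const_mul_field]

variable {g : ℝ → ℝ}

lemma discreteRate (hg : LevyKernel g) (hf : SmoothBdd f) (hw : SmoothBdd w) (K h : ℝ) :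
    SmoothBdd (discreteRate g K h f w) :=
  ((hf.mul (hw.centralDiff h)).add (hw.numVisc K h)).sub (hw.Lop (hg.trunc h))

/-- The i = 0 term of Leibniz' rule is the same scheme acting on the top derivative with velocity
`f`, to which the maximum principle applies. In the remaining commutator only derivatives of order
below k are differenced. -/
lemma iteratedDeriv_discreteRate (hg : LevyKernel g) (hf : SmoothBdd f) (K h : ℝ) (k : ℕ)
    (x : ℝ) : _root_.iteratedDeriv k (_root_.discreteRate g K h f f) x =
      _root_.discreteRate g K h f (_root_.iteratedDeriv k f) x +
      ∑ i ∈ Finset.range k, (k.choose (i + 1) : ℝ) * _root_.iteratedDeriv (i + 1) f x *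
        _root_.centralDiff h (_root_.iteratedDeriv (k - (i + 1)) f) x := by
  have e : _root_.discreteRate g K h f f = fun x => (fun x => f x * _root_.centralDiff h f x +
    _root_.numVisc K h f x) x - _root_.Lop (truncKernel g h) f x := rfl
  rw [e, ((hf.mul (hf.centralDiff h)).add (hf.numVisc K h)).iteratedDeriv_sub
    (hf.Lop (hg.trunc h)), (hf.mul (hf.centralDiff h)).iteratedDeriv_add (hf.numVisc K h),
    hf.iteratedDeriv_mul (hf.centralDiff h), hf.iteratedDeriv_Lop (hg.trunc h),
    hf.iteratedDeriv_numVisc, Finset.sum_range_succ', _root_.discreteRate]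
  simp only [hf.iteratedDeriv_centralDiff, Nat.choose_zero_right, iteratedDeriv_zero, Nat.cast_one,
    one_mul, Nat.sub_zero]
  ring

lemma eulerStep (hg : LevyKernel g) (hf : SmoothBdd f) (K h δ : ℝ) :
    SmoothBdd (eulerStep g K h δ f) :=
  hf.add ((hf.discreteRate hg hf K h).const_mul δ)

lemma scheme (hg : LevyKernel g) (hf : SmoothBdd f) (K h δ : ℝ) (n : ℕ) :
    SmoothBdd (scheme g K h δ f n) := by
  induction n with
  | zero => exact hf
  | succ n ih =>
    rw [_root_.scheme, Function.iterate_succ_apply']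
    exact ih.eulerStep hg K h δ

end SmoothBdd

lemma scheme_zero (g : ℝ → ℝ) (K h δ : ℝ) (f : ℝ → ℝ) : scheme g K h δ f 0 = f := rfl

lemma scheme_succ (g : ℝ → ℝ) (K h δ : ℝ) (f : ℝ → ℝ) (n : ℕ) :
    scheme g K h δ f (n + 1) = eulerStep g K h δ (scheme g K h δ f n) :=
  Function.iterate_succ_apply' _ _ _

lemma scheme_add (g : ℝ → ℝ) (K h δ : ℝ) (f : ℝ → ℝ) (n j : ℕ) :
    scheme g K h δ f (n + j) = scheme g K h δ (scheme g K h δ f n) j := by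
  rw [scheme, add_comm, Function.iterate_add_apply]; rfl

lemma periodic_Lop {g f : ℝ → ℝ} {ℓ : ℝ} (hf : Function.Periodic f ℓ) :
    Function.Periodic (Lop g f) ℓ := by
  intro x
  have : ∀ y, f (x + ℓ + y) = f (x + y) := fun y => by
    rw [add_right_comm]; exact hf _
  simp only [Lop, this, hf x]

lemma periodic_scheme {g f : ℝ → ℝ} {K h δ ℓ : ℝ} (hf : Function.Periodic f ℓ) (n : ℕ) :
    Function.Periodic (scheme g K h δ f n) ℓ := by
  induction n with
  | zero => exact hf
  | succ n ih =>
    rw [scheme_succ]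
    intro x
    have := periodic_Lop (g := truncKernel g h) ih x
    have h1 : ∀ y, scheme g K h δ f n (x + ℓ + y) = scheme g K h δ f n (x + y) := fun y => by
      rw [add_right_comm]; exact ih _
    simp only [eulerStep, discreteRate, centralDiff, numVisc, h1, ih x, this]

/-- The kernel is even and the stencil symmetric. Oddness of the solution is what later makes it
vanish at 0 and have mean zero over a period. -/
lemma odd_scheme {g f : ℝ → ℝ} (hg : LevyKernel g) {K h δ : ℝ} (hf : ∀ x, f (-x) = -f x) (n : ℕ)
    (x : ℝ) : scheme g K h δ f n (-x) = -scheme g K h δ f n x := by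
  induction n generalizing x with
  | zero => exact hf x
  | succ n ih =>
    rw [scheme_succ]
    set u := scheme g K h δ f n
    have hL : Lop (truncKernel g h) u (-x) = -Lop (truncKernel g h) u x := by
      rw [Lop, Lop, ← integral_neg, ← integral_neg_eq_self]
      congr 1
      funext y
      rw [(hg.trunc h).even, ← neg_add, ih, ih]; ring
    have e1 : u (-x + h) = -u (x + -h) := by rw [← ih]; congr 1; ring
    have e2 : u (-x + -h) = -u (x + h) := by rw [← ih]; congr 1; ring
    simp only [eulerStep, discreteRate, centralDiff, numVisc, hL, e1, e2, ih]
    ring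

/-! ### Derivative bounds uniform in the mesh -/

namespace CFL

variable {g : ℝ → ℝ} {K h δ : ℝ} (hc : CFL g K h δ) {f : ℝ → ℝ}
include hc

lemma abs_scheme_le (hf : SmoothBdd f) (h0 : ∀ x, |f x| ≤ K) (n : ℕ) (x : ℝ) :
    |scheme g K h δ f n x| ≤ K := by
  induction n generalizing x with
  | zero => exact h0 x
  | succ n ih =>
    rw [scheme_succ]
    exact hc.abs_add_discreteRate_le (hf.scheme hc.levy K h δ n).continuous ih ih x

/-- The maximum principle handles the transported top derivative, and the binomial weights of the
commutator sum to at most 2^k. The hypothesis bounds products of derivatives, not each factor, so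
that the growth can be quadratic in the slope for k = 1 and linear in the top derivative for k ≥ 2.
The two points differ because a difference quotient sees the derivative at other points. -/
lemma abs_iteratedDeriv_eulerStep_le (hf : SmoothBdd f) (h0 : ∀ x, |f x| ≤ K) {k : ℕ} (hk : 0 < k) {R Q : ℝ}
    (hR : ∀ x, |iteratedDeriv k f x| ≤ R)
    (hQ : ∀ i < k, ∀ x y, |iteratedDeriv (i + 1) f x| * |iteratedDeriv (k - (i + 1) + 1) f y| ≤ Q)
    (x : ℝ) : |iteratedDeriv k (eulerStep g K h δ f) x| ≤ R + δ * (2 ^ k * Q) := by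
  have hg := hc.levy
  have hδ := hc.δ_pos
  have e : iteratedDeriv k (eulerStep g K h δ f) x = (iteratedDeriv k f x +
      δ * discreteRate g K h f (iteratedDeriv k f) x) +
      δ * ∑ i ∈ Finset.range k, (k.choose (i + 1) : ℝ) * iteratedDeriv (i + 1) f x *
        centralDiff h (iteratedDeriv (k - (i + 1)) f) x := by
    have := hf.iteratedDeriv_add ((hf.discreteRate hg hf K h).const_mul δ) k x
    rw [iteratedDeriv_const_mul_field, hf.iteratedDeriv_discreteRate hg] at this
    refine this.trans ?_
    ring
  rw [e]
  refine (abs_add_le _ _).trans (add_le_add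
    (hc.abs_add_discreteRate_le (hf.iteratedDeriv k).continuous h0 hR x) ?_)
  rw [abs_mul, abs_of_pos hδ]
  refine mul_le_mul_of_nonneg_left ?_ hδ.le
  have hQ0 : 0 ≤ Q := (mul_nonneg (abs_nonneg _) (abs_nonneg _)).trans (hQ 0 hk 0 0)
  calc _ ≤ ∑ i ∈ Finset.range k, |(k.choose (i + 1) : ℝ) * iteratedDeriv (i + 1) f x *
        centralDiff h (iteratedDeriv (k - (i + 1)) f) x| := Finset.abs_sum_le_sum_abs _ _
    _ ≤ ∑ i ∈ Finset.range k, (k.choose (i + 1) : ℝ) * Q := by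
        refine Finset.sum_le_sum fun i hi => ?_
        rw [mul_assoc, abs_mul, Nat.abs_cast, abs_mul]
        refine mul_le_mul_of_nonneg_left ?_ (Nat.cast_nonneg _)
        -- With x fixed and the first factor nonzero, dividing Q by it gives a Lipschitz constant
        -- for the differenced factor.
        rcases (abs_nonneg (iteratedDeriv (i + 1) f x)).eq_or_lt with h0 | hpos
        · rw [← h0, zero_mul]; exact hQ0
        · rw [mul_comm, ← le_div_iff₀ hpos]
          refine abs_centralDiff_le hc.h_pos (hf.lipschitz_iteratedDeriv fun y => ?_) x
          rw [le_div_iff₀ hpos, mul_comm]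
          exact hQ i (Finset.mem_range.1 hi) x y
    _ = (∑ i ∈ Finset.range k, (k.choose (i + 1) : ℝ)) * Q := by rw [Finset.sum_mul]
    _ ≤ 2 ^ k * Q := by
        refine mul_le_mul_of_nonneg_right ?_ hQ0
        have h1 := Nat.sum_range_choose k
        rw [Finset.sum_range_succ'] at h1
        have h2 : ∑ i ∈ Finset.range k, k.choose (i + 1) ≤ 2 ^ k := by omega
        exact_mod_cast h2

/-- The discrete Riccati bound for the slope. -/
lemma abs_deriv_scheme_le (hf : SmoothBdd f) (h0 : ∀ x, |f x| ≤ K) {B : ℝ}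
    (h1 : ∀ x, |deriv f x| ≤ B) (j : ℕ) (hj : 8 * B * (j * δ) ≤ 1) (x : ℝ) :
    |deriv (scheme g K h δ f j) x| ≤ 2 * B := by
  have hB : 0 ≤ B := (abs_nonneg _).trans (h1 0)
  have hδ := hc.δ_pos
  -- As long as the slope is at most 2B, one step adds at most δ·2·(2B)² = 8B²δ. The restriction on
  -- j keeps the accumulated sum below 2B.
  suffices H : ∀ x, |deriv (scheme g K h δ f j) x| ≤ B + 8 * B ^ 2 * (j * δ) by
    refine (H x).trans ?_
    nlinarith
  clear x
  induction j with
  | zero => simpa [scheme_zero] using h1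
  | succ j ih =>
    push_cast at hj ⊢
    have hj' : 8 * B * (j * δ) ≤ 1 := by nlinarith
    have ih := ih hj'
    intro x
    rw [scheme_succ, ← iteratedDeriv_one]
    have hb : ∀ x, |iteratedDeriv 1 (scheme g K h δ f j) x| ≤ 2 * B := by
      intro y
      rw [iteratedDeriv_one]
      refine (ih y).trans ?_
      nlinarith
    have := hc.abs_iteratedDeriv_eulerStep_le (hf.scheme hc.levy K h δ j)
      (hc.abs_scheme_le hf h0 j) one_pos (R := B + 8 * B ^ 2 * (j * δ)) (Q := 2 * B * (2 * B))
      (by simpa [iteratedDeriv_one] using ih) (fun i hi x y => by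
        obtain rfl : i = 0 := by omega
        exact mul_le_mul (hb x) (hb y) (abs_nonneg _) (by positivity)) x
    refine this.trans (le_of_eq ?_)
    ring

/-- One step of the bound on higher derivatives by those of lower order. -/
lemma abs_iteratedDeriv_scheme_le (hf : SmoothBdd f) (h0 : ∀ x, |f x| ≤ K) {k : ℕ} {B D R T : ℝ}
    (hR : ∀ x, |iteratedDeriv (k + 2) f x| ≤ R) (hB0 : 0 ≤ B)
    (hB : ∀ n : ℕ, n * δ ≤ T → ∀ x, |deriv (scheme g K h δ f n) x| ≤ B)
    (hD : ∀ n : ℕ, n * δ ≤ T → ∀ j ≤ k + 1, ∀ x, |iteratedDeriv j (scheme g K h δ f n) x| ≤ D)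
    (n : ℕ) (hn : n * δ ≤ T) (x : ℝ) : |iteratedDeriv (k + 2) (scheme g K h δ f n) x| ≤
      (R + 2 ^ (k + 2) * D ^ 2 * (n * δ)) * Real.exp (2 ^ (k + 2) * B * (n * δ)) := by
  have hδ := hc.δ_pos
  have hR0 : 0 ≤ R := (abs_nonneg _).trans (hR 0)
  induction n generalizing x with
  | zero => simpa [scheme_zero] using hR x
  | succ n ih =>
    push_cast at hn ⊢
    have hn' : n * δ ≤ T := by nlinarith
    have ih := ih hn'
    have hB := hB n hn'
    have hD := hD n hn'
    have hD0 : 0 ≤ D := (abs_nonneg _).trans (hD 0 (by omega) 0)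
    set c : ℝ := 2 ^ (k + 2) with hcdef
    have hc0 : 0 < c := by positivity
    set Rn := (R + c * D ^ 2 * (n * δ)) * Real.exp (c * B * (n * δ)) with hRn
    have hRn0 : 0 ≤ Rn := by positivity
    rw [scheme_succ]
    -- The two orders in each product add up to k + 3. A factor of top order k + 2 is thus paired
    -- with a slope, which gives `B * Rn`; all other products have lower order and are bounded by `D
    -- ^ 2`. What results is a discrete Gronwall recursion.
    have := hc.abs_iteratedDeriv_eulerStep_le (hf.scheme hc.levy K h δ n)
      (hc.abs_scheme_le hf h0 n) (k := k + 2) (by omega) (R := Rn) (Q := B * Rn + D ^ 2)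
      ih (fun i hi x y => ?_) x
    · refine this.trans ?_
      have e1 : Real.exp (c * B * ((n + 1) * δ)) =
          Real.exp (c * B * (n * δ)) * Real.exp (c * B * δ) := by
        rw [← Real.exp_add]; ring_nf
      have e2 : 1 + c * B * δ ≤ Real.exp (c * B * δ) := by
        linarith [Real.add_one_le_exp (c * B * δ)]
      have e3 : 1 ≤ Real.exp (c * B * ((n + 1) * δ)) := Real.one_le_exp (by positivity)
      calc _ = Rn * (1 + c * B * δ) + c * D ^ 2 * δ := by rw [← hcdef]; ring
        _ ≤ Rn * Real.exp (c * B * δ) + c * D ^ 2 * δ * Real.exp (c * B * ((n + 1) * δ)) :=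
            add_le_add (mul_le_mul_of_nonneg_left e2 hRn0)
              (le_mul_of_one_le_right (by positivity) e3)
        _ = _ := by rw [hRn, e1]; ring
    · rcases Nat.eq_zero_or_pos i with rfl | hi0
      · have h1 := hB x
        rw [← iteratedDeriv_one] at h1
        have h2 := ih y
        have : |iteratedDeriv (0 + 1) (scheme g K h δ f n) x| *
            |iteratedDeriv (k + 2 - (0 + 1) + 1) (scheme g K h δ f n) y| ≤ B * Rn := by
          have e : k + 2 - (0 + 1) + 1 = k + 2 := by omega
          rw [e]
          exact mul_le_mul h1 h2 (abs_nonneg _) hB0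
        nlinarith [sq_nonneg D]
      · rcases Nat.lt_or_ge i (k + 1) with hik | hik
        · have := mul_le_mul (hD (i + 1) (by omega) x) (hD (k + 2 - (i + 1) + 1) (by omega) y)
            (abs_nonneg _) hD0
          nlinarith [mul_nonneg hB0 hRn0]
        · obtain rfl : i = k + 1 := by omega
          have h1 := hB y
          rw [← iteratedDeriv_one] at h1
          have h2 := ih x
          have e : k + 2 - (k + 1 + 1) + 1 = 1 := by omega
          rw [e]
          have := mul_le_mul h2 h1 (abs_nonneg _) hRn0
          nlinarith [sq_nonneg D]

end CFL

/-- Bounds on all derivatives of the scheme, uniform in the discretization, in terms of a bound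
on the slope. -/
lemma exists_bound_scheme {g : ℝ → ℝ} {K : ℝ} {f : ℝ → ℝ} (hf : SmoothBdd f)
    (h0 : ∀ x, |f x| ≤ K) {B T : ℝ} (hB0 : 0 ≤ B) (k : ℕ) :
    ∃ D, 0 ≤ D ∧ ∀ h δ, CFL g K h δ →
      (∀ n : ℕ, n * δ ≤ T → ∀ x, |deriv (scheme g K h δ f n) x| ≤ B) →
      ∀ n : ℕ, n * δ ≤ T → ∀ j ≤ k, ∀ x, |iteratedDeriv j (scheme g K h δ f n) x| ≤ D := by
  have hK0 : 0 ≤ K := (abs_nonneg _).trans (h0 0)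
  have base : ∀ h δ, CFL g K h δ →
      (∀ n : ℕ, n * δ ≤ T → ∀ x, |deriv (scheme g K h δ f n) x| ≤ B) →
      ∀ n : ℕ, n * δ ≤ T → ∀ j ≤ 1, ∀ x, |iteratedDeriv j (scheme g K h δ f n) x| ≤ max K B := by
    intro h δ hc hB n hn j hj x
    rcases Nat.le_one_iff_eq_zero_or_eq_one.1 hj with rfl | rfl
    · rw [iteratedDeriv_zero]
      exact (hc.abs_scheme_le hf h0 n x).trans (le_max_left _ _)
    · rw [iteratedDeriv_one]
      exact (hB n hn x).trans (le_max_right _ _)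
  rcases Nat.eq_zero_or_pos k with rfl | hk
  · exact ⟨max K B, hK0.trans (le_max_left _ _), fun h δ hc hB n hn j hj =>
      base h δ hc hB n hn j (by omega)⟩
  obtain ⟨k, rfl⟩ : ∃ m, k = m + 1 := ⟨k - 1, by omega⟩
  clear hk
  induction k with
  | zero => exact ⟨max K B, hK0.trans (le_max_left _ _), base⟩
  | succ k ih =>
    obtain ⟨D, hD0, hD⟩ := ih
    obtain ⟨R, hR⟩ := hf.bdd (k + 2)
    have hR0 : 0 ≤ R := (abs_nonneg _).trans (hR 0)
    refine ⟨max D ((R + 2 ^ (k + 2) * D ^ 2 * T) * Real.exp (2 ^ (k + 2) * B * T)),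
      hD0.trans (le_max_left _ _), fun h δ hc hB n hn j hj x => ?_⟩
    rcases Nat.lt_or_ge j (k + 2) with hjk | hjk
    · exact (hD h δ hc hB n hn j (by omega) x).trans (le_max_left _ _)
    · obtain rfl : j = k + 2 := by omega
      refine le_trans ?_ (le_max_right _ _)
      have hδ := hc.δ_pos
      have hT : 0 ≤ T := le_trans (by positivity) hn
      refine (hc.abs_iteratedDeriv_scheme_le hf h0 hR hB0 hB (hD h δ hc hB) n hn x).trans ?_
      gcongr

/-! ### Variation of the scheme in time -/

namespace CFL

variable {g : ℝ → ℝ} {K h δ : ℝ} (hc : CFL g K h δ) {f : ℝ → ℝ}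
include hc

/-- A bound on the derivatives of the discretized right-hand side. -/
lemma abs_iteratedDeriv_discreteRate_le (hf : SmoothBdd f) {k : ℕ} {D : ℝ}
    (hD : ∀ j ≤ k + 1, ∀ x, |iteratedDeriv j f x| ≤ D) (x : ℝ) :
    |iteratedDeriv k (discreteRate g K h f f) x| ≤
      (1 + 2 ^ k) * D ^ 2 + K * D + 3 * D * kernelMass g := by
  have hD0 : 0 ≤ D := (abs_nonneg _).trans (hD 0 (by omega) 0)
  rw [hf.iteratedDeriv_discreteRate hc.levy]
  have a1 := abs_discreteRate_le (u := iteratedDeriv k f) hc.levy hc.K_nonneg hc.h_pos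
    (by simpa using hD 0 (by omega)) (hD k (by omega))
    (hf.lipschitz_iteratedDeriv (hD (k + 1) le_rfl)) x
  have a2 : |∑ i ∈ Finset.range k, (k.choose (i + 1) : ℝ) * iteratedDeriv (i + 1) f x *
        centralDiff h (iteratedDeriv (k - (i + 1)) f) x| ≤ 2 ^ k * D ^ 2 := by
    calc _ ≤ ∑ i ∈ Finset.range k, |(k.choose (i + 1) : ℝ) * iteratedDeriv (i + 1) f x *
          centralDiff h (iteratedDeriv (k - (i + 1)) f) x| := Finset.abs_sum_le_sum_abs _ _
      _ ≤ ∑ i ∈ Finset.range k, (k.choose (i + 1) : ℝ) * D ^ 2 := by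
          refine Finset.sum_le_sum fun i hi => ?_
          have := Finset.mem_range.1 hi
          rw [mul_assoc, abs_mul, Nat.abs_cast, abs_mul, sq]
          refine mul_le_mul_of_nonneg_left ?_ (Nat.cast_nonneg _)
          exact mul_le_mul (hD _ (by omega) x) (abs_centralDiff_le hc.h_pos
            (hf.lipschitz_iteratedDeriv (hD _ (by omega))) x) (abs_nonneg _) hD0
      _ = (∑ i ∈ Finset.range k, (k.choose (i + 1) : ℝ)) * D ^ 2 := by rw [Finset.sum_mul]
      _ ≤ 2 ^ k * D ^ 2 := by
          refine mul_le_mul_of_nonneg_right ?_ (sq_nonneg D)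
          have h1 := Nat.sum_range_choose k
          rw [Finset.sum_range_succ'] at h1
          have h2 : ∑ i ∈ Finset.range k, k.choose (i + 1) ≤ 2 ^ k := by omega
          exact_mod_cast h2
  refine (abs_add_le _ _).trans ((add_le_add a1 a2).trans (le_of_eq ?_))
  ring

/-- The discretized right-hand side varies by `O(δ)` over one time step. -/
lemma abs_discreteRate_eulerStep_sub_le (hf : SmoothBdd f) {D E : ℝ}
    (hD : ∀ x, |deriv f x| ≤ D) (hD0 : ∀ x, |eulerStep g K h δ f x| ≤ D)
    (hE0 : ∀ x, |discreteRate g K h f f x| ≤ E)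
    (hE1 : ∀ x, |deriv (discreteRate g K h f f) x| ≤ E) (x : ℝ) :
    |discreteRate g K h (eulerStep g K h δ f) (eulerStep g K h δ f) x -
      discreteRate g K h f f x| ≤ δ * (2 * D * E + K * E + 3 * E * kernelMass g) := by
  have hg := hc.levy
  have hF := hf.discreteRate hg hf K h
  set F := discreteRate g K h f f with hFdef
  obtain ⟨B₀, b0⟩ := hf.bdd_zero
  have lF := abs_sub_le_of_hasDerivAt hF.hasDerivAt hE1
  have hL : Lop (truncKernel g h) (eulerStep g K h δ f) x =
      Lop (truncKernel g h) f x + δ * Lop (truncKernel g h) F x := by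
    rw [Lop, Lop, Lop, ← integral_const_mul, ← integral_add
      ((hg.trunc h).integrable hf.continuous b0 (abs_sub_le_of_hasDerivAt hf.hasDerivAt hD) x)
      (((hg.trunc h).integrable hF.continuous hE0 lF x).const_mul δ)]
    congr 1
    funext y
    simp only [eulerStep, ← hFdef]
    ring
  -- The rate is linear apart from one bilinear term, so this expansion is exact: the δ²
  -- contribution is absorbed by evaluating the velocity at the new step.
  have key : discreteRate g K h (eulerStep g K h δ f) (eulerStep g K h δ f) x - F x =
      δ * (F x * centralDiff h f x + discreteRate g K h (eulerStep g K h δ f) F x) := by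
    have hFx : F x = f x * centralDiff h f x + numVisc K h f x - Lop (truncKernel g h) f x := rfl
    have he : ∀ y, eulerStep g K h δ f y = f y + δ * F y := fun _ => rfl
    simp only [discreteRate, hL, centralDiff, numVisc, he] at hFx ⊢
    linear_combination (-1) * hFx
  rw [key, abs_mul, abs_of_pos hc.δ_pos]
  refine mul_le_mul_of_nonneg_left ?_ hc.δ_pos.le
  have a1 := abs_discreteRate_le hg hc.K_nonneg hc.h_pos hD0 hE0 lF x
  have hE : 0 ≤ E := (abs_nonneg _).trans (hE0 x)
  have a2 : |F x * centralDiff h f x| ≤ E * D := by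
    rw [abs_mul]
    exact mul_le_mul (hE0 x) (abs_centralDiff_le hc.h_pos
      (abs_sub_le_of_hasDerivAt hf.hasDerivAt hD) x) (abs_nonneg _) hE
  refine (abs_add_le _ _).trans ((add_le_add a2 a1).trans (le_of_eq ?_))
  ring

end CFL

/-! ### Limits along an ultrafilter -/

/-- The limit of a real sequence along the hyperfilter. -/
noncomputable def ulim (a : ℕ → ℝ) : ℝ := limUnder (hyperfilter ℕ : Filter ℕ) a

/-- An ultrafilter on a compact interval converges, so `limUnder` takes its meaningful value on
every sequence that is bounded on a large set. -/
lemma tendsto_ulim {a : ℕ → ℝ} {B : ℝ} (h : ∀ᶠ N in (hyperfilter ℕ : Filter ℕ), |a N| ≤ B) :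
    Tendsto a (hyperfilter ℕ) (𝓝 (ulim a)) := by
  refine tendsto_nhds_limUnder ?_
  obtain ⟨x, -, hx⟩ := (isCompact_Icc (a := -B) (b := B)).ultrafilter_le_nhds
    ((hyperfilter ℕ).map a) (by
      rw [le_principal_iff, Ultrafilter.coe_map, mem_map]
      filter_upwards [h] with N hN using abs_le.1 hN)
  exact ⟨x, hx⟩

lemma hasDerivWithinAt_of_quadratic {p : ℝ → ℝ} {q B x : ℝ} {s : Set ℝ}
    (h : ∀ y ∈ s, |p y - p x - (y - x) * q| ≤ B * (y - x) ^ 2) : HasDerivWithinAt p q s x := by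
  rw [hasDerivWithinAt_iff_isLittleO]
  have h1 : (fun y => p y - p x - (y - x) • q) =O[𝓝[s] x] fun y => (y - x) ^ 2 := by
    refine Asymptotics.IsBigO.of_bound B ?_
    filter_upwards [self_mem_nhdsWithin] with y hy
    rw [Real.norm_eq_abs, Real.norm_eq_abs, abs_of_nonneg (sq_nonneg (y - x))]
    exact h y hy
  refine h1.trans_isLittleO ?_
  have h2 : (fun y => (y - x) * (y - x)) =o[𝓝[s] x] fun y => 1 * (y - x) := by
    refine Asymptotics.IsLittleO.mul_isBigO ?_ (Asymptotics.isBigO_refl _ _)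
    rw [Asymptotics.isLittleO_one_iff]
    have : Tendsto (fun y => y - x) (𝓝 x) (𝓝 0) := by
      have hc : Continuous fun y : ℝ => y - x := by fun_prop
      simpa using hc.tendsto x
    exact this.mono_left nhdsWithin_le_nhds
  simpa [sq] using h2

lemma abs_taylor_two_le {u u' u'' : ℝ → ℝ} {B : ℝ} (h : ∀ x, HasDerivAt u (u' x) x)
    (h' : ∀ x, HasDerivAt u' (u'' x) x) (hb : ∀ x, |u'' x| ≤ B) (x y : ℝ) :
    |u y - u x - (y - x) * u' x| ≤ B * (y - x) ^ 2 := by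
  have hB : 0 ≤ B := (abs_nonneg _).trans (hb 0)
  have lip := abs_sub_le_of_hasDerivAt h' hb
  have := (convex_uIcc x y).norm_image_sub_le_of_norm_hasDerivWithin_le
    (f := fun z => u z - z * u' x) (f' := fun z => u' z - 1 * u' x) (C := B * |y - x|)
    (x := x) (y := y)
    (fun z _ => ((h z).sub ((hasDerivAt_id z).mul_const _)).hasDerivWithinAt)
    (fun z hz => by
      rw [one_mul, Real.norm_eq_abs]
      exact (lip z x).trans (mul_le_mul_of_nonneg_left (abs_sub_left_of_mem_uIcc hz) hB))
    left_mem_uIcc right_mem_uIcc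
  rw [Real.norm_eq_abs, Real.norm_eq_abs, mul_assoc, abs_mul_abs_self, ← sq] at this
  convert this using 2
  ring

/-- A quadratic Taylor remainder with uniform constant survives pointwise limits, and in the limit
it identifies the derivative. -/
lemma hasDerivAt_ulim {u u' u'' : ℕ → ℝ → ℝ} {p q : ℝ → ℝ} {B : ℝ}
    (h : ∀ N x, HasDerivAt (u N) (u' N x) x) (h' : ∀ N x, HasDerivAt (u' N) (u'' N x) x)
    (hb : ∀ᶠ N in (hyperfilter ℕ : Filter ℕ), ∀ x, |u'' N x| ≤ B)
    (hp : ∀ x, Tendsto (fun N => u N x) (hyperfilter ℕ) (𝓝 (p x)))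
    (hq : ∀ x, Tendsto (fun N => u' N x) (hyperfilter ℕ) (𝓝 (q x))) (x : ℝ) :
    HasDerivAt p (q x) x := by
  rw [← hasDerivWithinAt_univ]
  refine hasDerivWithinAt_of_quadratic (B := B) fun y _ => ?_
  refine le_of_tendsto (((hp y).sub (hp x)).sub ((hq x).const_mul (y - x))).abs ?_
  filter_upwards [hb] with N hN
  exact abs_taylor_two_le (h N) (h' N) hN x y

/-- Derivatives pass to the limit along the hyperfilter. -/
lemma smoothBdd_ulim {u : ℕ → ℝ → ℝ} (hu : ∀ N, SmoothBdd (u N)) {D : ℕ → ℝ}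
    (hD : ∀ k, ∀ᶠ N in (hyperfilter ℕ : Filter ℕ), ∀ x, |iteratedDeriv k (u N) x| ≤ D k) :
    SmoothBdd (fun x => ulim fun N => u N x) ∧ ∀ k x,
      Tendsto (fun N => iteratedDeriv k (u N) x) (hyperfilter ℕ)
        (𝓝 (iteratedDeriv k (fun x => ulim fun N => u N x) x)) := by
  set p : ℝ → ℝ := fun x => ulim fun N => u N x with hp
  have lim : ∀ k x, Tendsto (fun N => iteratedDeriv k (u N) x) (hyperfilter ℕ)
      (𝓝 (ulim fun N => iteratedDeriv k (u N) x)) := fun k x =>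
    tendsto_ulim ((hD k).mono fun N hN => hN x)
  have der : ∀ k x, HasDerivAt (fun x => ulim fun N => iteratedDeriv k (u N) x)
      (ulim fun N => iteratedDeriv (k + 1) (u N) x) x := fun k =>
    hasDerivAt_ulim (fun N => (hu N).hasDerivAt_iteratedDeriv k)
      (fun N => (hu N).hasDerivAt_iteratedDeriv (k + 1)) (hD (k + 2)) (lim k) (lim (k + 1))
  have eq : ∀ k, iteratedDeriv k p = fun x => ulim fun N => iteratedDeriv k (u N) x := by
    intro k
    induction k with
    | zero => simp [hp]
    | succ k ih =>
      rw [iteratedDeriv_succ, ih]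
      exact funext fun x => (der k x).deriv
  refine ⟨⟨contDiff_of_differentiable_iteratedDeriv fun k _ => ?_, fun k => ⟨D k, fun x => ?_⟩⟩,
    fun k x => ?_⟩
  · rw [eq]
    exact fun x => (der k x).differentiableAt
  · rw [eq]
    exact le_of_tendsto (lim k x).abs ((hD k).mono fun N hN => hN x)
  · rw [eq]
    exact lim k x

/-- Pointwise convergence of equi-Lipschitz periodic functions is uniform. -/
lemma eventually_abs_sub_le_of_periodic {u : ℕ → ℝ → ℝ} {p : ℝ → ℝ} {ℓ B ε : ℝ} {F : Filter ℕ}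
    (hℓ : 0 < ℓ) (hε : 0 < ε)
    (hu : ∀ N, Function.Periodic (u N) ℓ) (hpp : Function.Periodic p ℓ)
    (hb : ∀ᶠ N in F, ∀ x y, |u N x - u N y| ≤ B * |x - y|)
    (hpl : ∀ x y, |p x - p y| ≤ B * |x - y|)
    (hp : ∀ x, Tendsto (fun N => u N x) F (𝓝 (p x))) :
    ∀ᶠ N in F, ∀ x, |u N x - p x| ≤ ε := by
  have hB : 0 ≤ B := by
    have := (abs_nonneg _).trans (hpl 1 0)
    simpa using this
  set r := ε / (4 * (B + 1)) with hr
  have hr0 : 0 < r := by positivity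
  have hrB : B * r ≤ ε / 4 := by
    rw [hr, ← mul_div_assoc, div_le_div_iff₀ (by positivity) (by norm_num)]
    nlinarith
  obtain ⟨t, -, htf, ht⟩ := (isCompact_Icc (a := 0) (b := ℓ)).finite_cover_balls hr0
  have h1 : ∀ᶠ N in F, ∀ z ∈ t, |u N z - p z| < ε / 2 := by
    rw [eventually_all_finite htf]
    intro z _
    have := (hp z).eventually (Metric.ball_mem_nhds (p z) (half_pos hε))
    filter_upwards [this] with N hN
    simpa [Real.dist_eq] using hN
  filter_upwards [h1, hb] with N hN hbN x
  obtain ⟨y, hy, hxy⟩ := ((hu N).sub hpp).exists_mem_Ico₀ hℓ x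
  have hxy : u N x - p x = u N y - p y := hxy
  rw [hxy]
  have hy' := ht (Ico_subset_Icc_self hy)
  simp only [mem_iUnion, exists_prop] at hy'
  obtain ⟨z, hz, hyz⟩ := hy'
  rw [Metric.mem_ball, Real.dist_eq] at hyz
  have e1 := hbN y z
  have e2 := hpl z y
  rw [abs_sub_comm z y] at e2
  have e3 : B * |y - z| ≤ ε / 4 := (mul_le_mul_of_nonneg_left hyz.le hB).trans hrB
  have e4 := hN z hz
  rw [show u N y - p y = (u N y - u N z) + (u N z - p z) + (p z - p y) by ring]
  have := abs_add_three (u N y - u N z) (u N z - p z) (p z - p y)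
  linarith

/-- The right-hand side `f fₓ - ℒ f` of the equation. -/
noncomputable def burgersRate (g f : ℝ → ℝ) (x : ℝ) : ℝ := f x * deriv f x - Lop g f x

/-- Consistency of the scheme. Taylor's formula with a uniform second derivative makes the error of
the centred difference and the numerical viscosity O(h). The nonlocal term needs uniform
convergence, which periodicity and equi-Lipschitz bounds supply. -/
lemma tendsto_discreteRate {g : ℝ → ℝ} (hg : LevyKernel g) {u : ℕ → ℝ → ℝ} {K ℓ : ℝ} {h : ℕ → ℝ}
    (hℓ : 0 < ℓ) (hK : 0 ≤ K) (hh : ∀ N, 0 < h N) (hh0 : Tendsto h (hyperfilter ℕ) (𝓝 0))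
    (hu : ∀ N, SmoothBdd (u N)) (hper : ∀ N, Function.Periodic (u N) ℓ) {D : ℕ → ℝ}
    (hD : ∀ k, ∀ᶠ N in (hyperfilter ℕ : Filter ℕ), ∀ x, |iteratedDeriv k (u N) x| ≤ D k) (x : ℝ) :
    Tendsto (fun N => discreteRate g K (h N) (u N) (u N) x) (hyperfilter ℕ)
      (𝓝 (burgersRate g (fun x => ulim fun N => u N x) x)) := by
  obtain ⟨hp, lim⟩ := smoothBdd_ulim hu hD
  set p : ℝ → ℝ := fun x => ulim fun N => u N x with hpdef
  have lim0 : ∀ x, Tendsto (fun N => u N x) (hyperfilter ℕ) (𝓝 (p x)) := by simpa using lim 0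
  have lim1 : ∀ x, Tendsto (fun N => deriv (u N) x) (hyperfilter ℕ) (𝓝 (deriv p x)) := by
    simpa [iteratedDeriv_one] using lim 1
  have hpper : Function.Periodic p ℓ := fun x => by simp only [hpdef, hper _ x]
  have hD0 : ∀ x, |p x| ≤ D 0 := fun x => le_of_tendsto (lim0 x).abs ((hD 0).mono fun N hN => by
    simpa using hN x)
  have lipN : ∀ᶠ N in (hyperfilter ℕ : Filter ℕ), ∀ x y, |u N x - u N y| ≤ D 1 * |x - y| := by
    filter_upwards [hD 1] with N hN
    simpa using (hu N).lipschitz_iteratedDeriv (k := 0) hN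
  have lip : ∀ x y, |p x - p y| ≤ D 1 * |x - y| := fun x y =>
    le_of_tendsto ((lim0 x).sub (lim0 y)).abs (lipN.mono fun N hN => hN x y)
  have hD1 : 0 ≤ D 1 := by
    have := (abs_nonneg _).trans (lip 1 0)
    simpa using this
  have hD2 : 0 ≤ D 2 := by
    obtain ⟨N, hN⟩ := (hD 2).exists
    exact (abs_nonneg _).trans (hN 0)
  have taylor : ∀ᶠ N in (hyperfilter ℕ : Filter ℕ), ∀ y,
      |u N y - u N x - (y - x) * deriv (u N) x| ≤ D 2 * (y - x) ^ 2 := by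
    filter_upwards [hD 2] with N hN y
    have := abs_taylor_two_le (hu N).hasDerivAt (u'' := iteratedDeriv 2 (u N)) (fun z => by
      have := (hu N).hasDerivAt_iteratedDeriv 1 z
      rwa [iteratedDeriv_one] at this) hN x y
    exact this
  have cd : Tendsto (fun N => centralDiff (h N) (u N) x) (hyperfilter ℕ) (𝓝 (deriv p x)) := by
    have e : Tendsto (fun N => centralDiff (h N) (u N) x - deriv (u N) x) (hyperfilter ℕ)
        (𝓝 0) := by
      refine squeeze_zero_norm' (a := fun N => D 2 * h N) ?_ (by simpa using hh0.const_mul (D 2))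
      filter_upwards [taylor] with N hN
      have h0 := hh N
      have t1 := hN (x + h N)
      have t2 := hN (x + -h N)
      simp only [add_sub_cancel_left] at t1 t2
      have : centralDiff (h N) (u N) x - deriv (u N) x = (2 * h N)⁻¹ *
          ((u N (x + h N) - u N x - h N * deriv (u N) x) -
            (u N (x + -h N) - u N x - -h N * deriv (u N) x)) := by
        rw [centralDiff]; field_simp; ring
      rw [this, Real.norm_eq_abs, abs_mul, abs_of_pos (by positivity),
        inv_mul_le_iff₀ (by positivity)]
      refine (abs_sub _ _).trans ((add_le_add t1 t2).trans (le_of_eq ?_))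
      ring
    simpa using e.add (lim1 x)
  have nv : Tendsto (fun N => numVisc K (h N) (u N) x) (hyperfilter ℕ) (𝓝 0) := by
    refine squeeze_zero_norm' (a := fun N => K * D 2 * h N) ?_
      (by simpa using hh0.const_mul (K * D 2))
    filter_upwards [taylor] with N hN
    have h0 := hh N
    have t1 := hN (x + h N)
    have t2 := hN (x + -h N)
    simp only [add_sub_cancel_left] at t1 t2
    have : numVisc K (h N) (u N) x = K * (2 * h N)⁻¹ *
        ((u N (x + h N) - u N x - h N * deriv (u N) x) +
          (u N (x + -h N) - u N x - -h N * deriv (u N) x)) := by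
      rw [numVisc]; ring
    rw [this, Real.norm_eq_abs, mul_assoc, abs_mul, abs_of_nonneg hK, mul_assoc]
    refine mul_le_mul_of_nonneg_left ?_ hK
    rw [abs_mul, abs_of_pos (by positivity), inv_mul_le_iff₀ (by positivity)]
    refine (abs_add_le _ _).trans ((add_le_add t1 t2).trans (le_of_eq ?_))
    ring
  have hL : Tendsto (fun N => Lop (truncKernel g (h N)) (u N) x) (hyperfilter ℕ)
      (𝓝 (Lop g p x)) := by
    rw [Metric.tendsto_nhds]
    intro η hη
    have m1 : Tendsto (fun e => (2 + 2 * D 1) * kernelModulus g e) (𝓝[>] 0) (𝓝 0) := by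
      simpa using (hg.tendsto_modulus.const_mul (2 + 2 * D 1)).mono_left nhdsWithin_le_nhds
    have m2 : Tendsto (fun N => D 1 * kernelModulus g (h N)) (hyperfilter ℕ) (𝓝 0) := by
      simpa [Function.comp_def] using (hg.tendsto_modulus.const_mul (D 1)).comp hh0
    -- The tolerance e is fixed before N: its modulus takes half of η, and the truncation at `h N`
    -- takes the other half.
    obtain ⟨e, he, he0⟩ := ((m1.eventually (gt_mem_nhds (half_pos hη))).and
      self_mem_nhdsWithin).exists
    filter_upwards [m2.eventually (gt_mem_nhds (half_pos hη)), lipN, hD 0,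
      eventually_abs_sub_le_of_periodic hℓ he0 hper hpper lipN lip lim0] with N h1 h2 h3 h4
    have := hg.abs_Lop_trunc_sub_le (A := D 0) (B := D 1) (le_of_lt he0) (hh N).le
      (hu N).continuous hp.continuous (by simpa using h3) hD0 h2 lip h4 x
    rw [Real.dist_eq]
    linarith
  have := (((lim0 x).mul cd).add nv).sub hL
  simpa [discreteRate, burgersRate] using this

/-! ### The limit of the scheme -/

/-- A kernel together with a smooth odd periodic datum bounded by `K`. -/
structure OddDatum (g : ℝ → ℝ) (K ℓ : ℝ) (f : ℝ → ℝ) : Prop where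
  levy : LevyKernel g
  period_pos : 0 < ℓ
  smooth : SmoothBdd f
  periodic : Function.Periodic f ℓ
  odd : ∀ x, f (-x) = -f x
  abs_le : ∀ x, |f x| ≤ K

/-- The mesh size of the `N`-th discretization. -/
noncomputable def meshSize (N : ℕ) : ℝ := 1 / ((N : ℝ) + 1)

/-- The time step of the `N`-th discretization. -/
noncomputable def timeStep (g : ℝ → ℝ) (K : ℝ) (N : ℕ) : ℝ :=
  -- The first two summands enforce the step-size restriction. The last one keeps the denominator
  -- positive when K = 0 and forces the step below the mesh size, hence to 0.
  1 / (K * ((N : ℝ) + 1) + (∫ y, truncKernel g (meshSize N) y) + ((N : ℝ) + 1))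

/-- The `n`-th iterate of the `N`-th discretization. -/
noncomputable def meshScheme (g : ℝ → ℝ) (K : ℝ) (f : ℝ → ℝ) (N n : ℕ) : ℝ → ℝ :=
  scheme g K (meshSize N) (timeStep g K N) f n

/-- The `N`-th discrete approximation at time `t`. -/
noncomputable def approx (g : ℝ → ℝ) (K : ℝ) (f : ℝ → ℝ) (t : ℝ) (N : ℕ) : ℝ → ℝ :=
  meshScheme g K f N ⌊t / timeStep g K N⌋₊

/-- The limit of the discrete approximations. -/
noncomputable def burgersLimit (g : ℝ → ℝ) (K : ℝ) (f : ℝ → ℝ) (t x : ℝ) : ℝ :=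
  ulim fun N => approx g K f t N x

/-- The slopes of the discrete approximations are uniformly bounded up to time `T`. -/
def SlopeControlled (g : ℝ → ℝ) (K : ℝ) (f : ℝ → ℝ) (T : ℝ) : Prop :=
  ∃ B, 0 ≤ B ∧ ∀ᶠ N in (hyperfilter ℕ : Filter ℕ), ∀ n : ℕ, n * timeStep g K N ≤ T →
    ∀ x, |deriv (meshScheme g K f N n) x| ≤ B

lemma SlopeControlled.mono {g : ℝ → ℝ} {K : ℝ} {f : ℝ → ℝ} {S T : ℝ}
    (h : SlopeControlled g K f T) (hST : S ≤ T) : SlopeControlled g K f S := by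
  obtain ⟨B, hB, h⟩ := h
  exact ⟨B, hB, h.mono fun N hN n hn => hN n (hn.trans hST)⟩

lemma meshSize_pos (N : ℕ) : 0 < meshSize N := by rw [meshSize]; positivity

lemma tendsto_hyperfilter_of_atTop {a : ℕ → ℝ} {b : ℝ} (h : Tendsto a atTop (𝓝 b)) :
    Tendsto a (hyperfilter ℕ) (𝓝 b) :=
  h.mono_left Nat.hyperfilter_le_atTop

lemma tendsto_meshSize : Tendsto meshSize (hyperfilter ℕ) (𝓝 0) :=
  tendsto_hyperfilter_of_atTop tendsto_one_div_add_atTop_nhds_zero_nat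

lemma burgersLimit_zero (g : ℝ → ℝ) (K : ℝ) (f : ℝ → ℝ) : burgersLimit g K f 0 = f := by
  funext x
  have : ∀ N, approx g K f 0 N x = f x := fun N => by simp [approx, meshScheme, scheme]
  simp only [burgersLimit, this]
  exact tendsto_nhds_unique (tendsto_ulim (B := |f x|) (Eventually.of_forall fun _ => le_rfl))
    tendsto_const_nhds

lemma meshScheme_succ (g : ℝ → ℝ) (K : ℝ) (f : ℝ → ℝ) (N n : ℕ) (x : ℝ) : meshScheme g K f N (n + 1) x =
    meshScheme g K f N n x + timeStep g K N * discreteRate g K (meshSize N)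
      (meshScheme g K f N n) (meshScheme g K f N n) x := by
  rw [meshScheme, scheme_succ]; rfl

/-! ### Passage to the limit and continuation -/

namespace OddDatum

variable {g : ℝ → ℝ} {K ℓ : ℝ} {f : ℝ → ℝ} (hd : OddDatum g K ℓ f)
include hd

lemma K_nonneg : 0 ≤ K := (abs_nonneg _).trans (hd.abs_le 0)

lemma timeStep_pos (N : ℕ) : 0 < timeStep g K N := by
  have h1 := hd.K_nonneg
  have h2 : 0 ≤ ∫ y, truncKernel g (meshSize N) y :=
    integral_nonneg (hd.levy.truncKernel_nonneg _)
  rw [timeStep]; positivity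

lemma timeStep_le (N : ℕ) : timeStep g K N ≤ meshSize N := by
  have h1 := hd.K_nonneg
  have h2 : 0 ≤ ∫ y, truncKernel g (meshSize N) y :=
    integral_nonneg (hd.levy.truncKernel_nonneg _)
  rw [timeStep]
  refine one_div_le_one_div_of_le (by positivity) ?_
  have : 0 ≤ K * ((N : ℝ) + 1) := by positivity
  linarith

lemma tendsto_timeStep : Tendsto (timeStep g K) (hyperfilter ℕ) (𝓝 0) :=
  squeeze_zero (fun N => (hd.timeStep_pos N).le) hd.timeStep_le tendsto_meshSize

lemma cfl (N : ℕ) : CFL g K (meshSize N) (timeStep g K N) where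
  levy := hd.levy
  K_nonneg := hd.K_nonneg
  h_pos := meshSize_pos N
  δ_pos := hd.timeStep_pos N
  le_one := by
    have h1 := hd.K_nonneg
    have h2 : 0 ≤ ∫ y, truncKernel g (meshSize N) y :=
      integral_nonneg (hd.levy.truncKernel_nonneg _)
    rw [timeStep, one_div_mul_eq_div, div_le_one (by positivity)]
    have : (meshSize N)⁻¹ = (N : ℝ) + 1 := by rw [meshSize, one_div, inv_inv]
    rw [this]
    linarith [Nat.cast_nonneg (α := ℝ) N]

lemma smooth_meshScheme (N n : ℕ) : SmoothBdd (meshScheme g K f N n) :=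
  hd.smooth.scheme hd.levy _ _ _ _

lemma floor_mul_le {t : ℝ} (ht : 0 ≤ t) (N : ℕ) :
    (⌊t / timeStep g K N⌋₊ : ℝ) * timeStep g K N ≤ t := by
  have h := hd.timeStep_pos N
  have := Nat.floor_le (div_nonneg ht h.le)
  rwa [le_div_iff₀ h] at this

lemma lt_floor_mul_add (t : ℝ) (N : ℕ) :
    t < ⌊t / timeStep g K N⌋₊ * timeStep g K N + timeStep g K N := by
  have h := hd.timeStep_pos N
  have := Nat.lt_floor_add_one (t / timeStep g K N)
  rw [div_lt_iff₀ h] at this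
  linarith

lemma tendsto_floor_mul {t : ℝ} (ht : 0 ≤ t) :
    Tendsto (fun N => (⌊t / timeStep g K N⌋₊ : ℝ) * timeStep g K N) (hyperfilter ℕ) (𝓝 t) := by
  refine tendsto_of_tendsto_of_tendsto_of_le_of_le (g := fun N => t - timeStep g K N)
    (by simpa using tendsto_const_nhds.sub hd.tendsto_timeStep) tendsto_const_nhds
    (fun N => ?_) (fun N => hd.floor_mul_le ht N)
  have := hd.lt_floor_mul_add t N
  simp only
  linarith

lemma exists_bound {T : ℝ} (hT : SlopeControlled g K f T) : ∃ D : ℕ → ℝ, (∀ k, 0 ≤ D k) ∧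
    ∀ k, ∀ᶠ N in (hyperfilter ℕ : Filter ℕ), ∀ n : ℕ, n * timeStep g K N ≤ T →
      ∀ j ≤ k, ∀ x, |iteratedDeriv j (meshScheme g K f N n) x| ≤ D k := by
  obtain ⟨B, hB, h⟩ := hT
  choose D hD0 hD using fun k => exists_bound_scheme (g := g) hd.smooth hd.abs_le (T := T) hB k
  exact ⟨D, hD0, fun k => h.mono fun N hN => hD k _ _ (hd.cfl N) hN⟩

lemma eventually_approx_bound {T : ℝ} {D : ℕ → ℝ}
    (hD : ∀ k, ∀ᶠ N in (hyperfilter ℕ : Filter ℕ), ∀ n : ℕ, n * timeStep g K N ≤ T →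
      ∀ j ≤ k, ∀ x, |iteratedDeriv j (meshScheme g K f N n) x| ≤ D k)
    {t : ℝ} (ht : t ∈ Icc 0 T) (k : ℕ) : ∀ᶠ N in (hyperfilter ℕ : Filter ℕ),
      ∀ x, |iteratedDeriv k (approx g K f t N) x| ≤ D k :=
  (hD k).mono fun N hN => hN _ ((hd.floor_mul_le ht.1 N).trans ht.2) k le_rfl

lemma smooth_burgersLimit {T : ℝ} (hT : SlopeControlled g K f T) {t : ℝ} (ht : t ∈ Icc 0 T) :
    SmoothBdd (burgersLimit g K f t) ∧ ∀ k x,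
      Tendsto (fun N => iteratedDeriv k (approx g K f t N) x) (hyperfilter ℕ)
        (𝓝 (iteratedDeriv k (burgersLimit g K f t) x)) := by
  obtain ⟨D, -, hD⟩ := hd.exists_bound hT
  exact smoothBdd_ulim (fun N => hd.smooth_meshScheme N _) (hd.eventually_approx_bound hD ht)

lemma bdd_burgersLimit {T : ℝ} (hT : SlopeControlled g K f T) (k : ℕ) :
    ∃ D, ∀ t ∈ Icc 0 T, ∀ x, |iteratedDeriv k (burgersLimit g K f t) x| ≤ D := by
  obtain ⟨D, -, hD⟩ := hd.exists_bound hT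
  exact ⟨D k, fun t ht x => le_of_tendsto ((hd.smooth_burgersLimit hT ht).2 k x).abs
    ((hd.eventually_approx_bound hD ht k).mono fun N hN => hN x)⟩

lemma periodic_burgersLimit (t : ℝ) : Function.Periodic (burgersLimit g K f t) ℓ := fun x => by
  have : ∀ N, approx g K f t N (x + ℓ) = approx g K f t N x := fun N =>
    periodic_scheme hd.periodic _ x
  simp only [burgersLimit, this]

lemma abs_burgersLimit_le (t x : ℝ) : |burgersLimit g K f t x| ≤ K := by
  have h : ∀ N, |approx g K f t N x| ≤ K := fun N =>
    (hd.cfl N).abs_scheme_le hd.smooth hd.abs_le _ x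
  exact le_of_tendsto (tendsto_ulim (Eventually.of_forall h)).abs (Eventually.of_forall h)

lemma burgersLimit_odd (t x : ℝ) : burgersLimit g K f t (-x) = -burgersLimit g K f t x := by
  have h : ∀ x N, |approx g K f t N x| ≤ K := fun x N =>
    (hd.cfl N).abs_scheme_le hd.smooth hd.abs_le _ x
  have h1 := tendsto_ulim (Eventually.of_forall (h (-x)))
  have h2 := (tendsto_ulim (Eventually.of_forall (h x))).neg
  refine tendsto_nhds_unique h1 (h2.congr fun N => ?_)
  exact (odd_scheme hd.levy hd.odd _ x).symm

/-- Each step moves the k-th derivative by at most δ times the bound on the k-th derivative of the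
rate, at the price of one more space derivative. The limit thereby inherits Lipschitz continuity in
time. -/
lemma abs_iteratedDeriv_meshScheme_sub_le {T : ℝ} {k : ℕ} {D : ℝ} {N : ℕ}
    (hD : ∀ n : ℕ, n * timeStep g K N ≤ T →
      ∀ j ≤ k + 1, ∀ x, |iteratedDeriv j (meshScheme g K f N n) x| ≤ D)
    (n j : ℕ) (hn : ((n + j : ℕ) : ℝ) * timeStep g K N ≤ T) (x : ℝ) :
    |iteratedDeriv k (meshScheme g K f N (n + j)) x - iteratedDeriv k (meshScheme g K f N n) x| ≤
      ((1 + 2 ^ k) * D ^ 2 + K * D + 3 * D * kernelMass g) * (j * timeStep g K N) := by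
  have hδ := hd.timeStep_pos N
  induction j with
  | zero => simp
  | succ j ih =>
    push_cast at hn ih ⊢
    have hn' : ((n : ℝ) + j) * timeStep g K N ≤ T := by nlinarith
    have ih := ih hn'
    set u := meshScheme g K f N (n + j) with hu
    have hs : SmoothBdd u := hd.smooth_meshScheme N _
    have e : meshScheme g K f N (n + (j + 1)) = fun x => u x + timeStep g K N *
        discreteRate g K (meshSize N) u u x := funext fun x => meshScheme_succ g K f N (n + j) x
    rw [e, hs.iteratedDeriv_add ((hs.discreteRate hd.levy hs K _).const_mul _),
      iteratedDeriv_const_mul_field]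
    have b := (hd.cfl N).abs_iteratedDeriv_discreteRate_le hs (k := k) (D := D)
      (hD (n + j) (by push_cast; exact hn')) x
    rw [show iteratedDeriv k u x + timeStep g K N *
      iteratedDeriv k (discreteRate g K (meshSize N) u u) x -
      iteratedDeriv k (meshScheme g K f N n) x = (iteratedDeriv k u x -
      iteratedDeriv k (meshScheme g K f N n) x) + timeStep g K N *
      iteratedDeriv k (discreteRate g K (meshSize N) u u) x by ring]
    refine (abs_add_le _ _).trans ?_
    rw [abs_mul, abs_of_pos hδ]
    have := mul_le_mul_of_nonneg_left b hδ.le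
    linarith

lemma exists_floor_eq_add {s t : ℝ} (hst : s ≤ t) (N : ℕ) : ∃ j : ℕ,
    ⌊t / timeStep g K N⌋₊ = ⌊s / timeStep g K N⌋₊ + j ∧
    (j : ℝ) * timeStep g K N = ⌊t / timeStep g K N⌋₊ * timeStep g K N -
      ⌊s / timeStep g K N⌋₊ * timeStep g K N := by
  have h : ⌊s / timeStep g K N⌋₊ ≤ ⌊t / timeStep g K N⌋₊ :=
    Nat.floor_mono (div_le_div_of_nonneg_right hst (hd.timeStep_pos N).le)
  refine ⟨⌊t / timeStep g K N⌋₊ - ⌊s / timeStep g K N⌋₊, by omega, ?_⟩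
  rw [Nat.cast_sub h]; ring

lemma lipschitz_burgersLimit {T : ℝ} (hT : SlopeControlled g K f T) (k : ℕ) :
    ∃ C, 0 ≤ C ∧ ∀ s ∈ Icc 0 T, ∀ t ∈ Icc 0 T, s ≤ t → ∀ x,
      |iteratedDeriv k (burgersLimit g K f t) x - iteratedDeriv k (burgersLimit g K f s) x| ≤
        C * (t - s) := by
  obtain ⟨D, hD0, hD⟩ := hd.exists_bound hT
  have := hd.K_nonneg
  have hG := hd.levy.kernelMass_nonneg
  have hDk := hD0 (k + 1)
  refine ⟨(1 + 2 ^ k) * D (k + 1) ^ 2 + K * D (k + 1) + 3 * D (k + 1) * kernelMass g, by positivity,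
    fun s hs t ht hst x => ?_⟩
  refine le_of_tendsto_of_tendsto (((hd.smooth_burgersLimit hT ht).2 k x).sub
    ((hd.smooth_burgersLimit hT hs).2 k x)).abs
    (((hd.tendsto_floor_mul ht.1).sub (hd.tendsto_floor_mul hs.1)).const_mul _) ?_
  filter_upwards [hD (k + 1)] with N hN
  obtain ⟨j, hj, hj'⟩ := hd.exists_floor_eq_add hst N
  rw [← hj', approx, approx, hj]
  exact hd.abs_iteratedDeriv_meshScheme_sub_le hN _ j
    (by rw [← hj]; exact (hd.floor_mul_le ht.1 N).trans ht.2) x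

/-- A discrete Taylor formula in time. The rate drifts by O(δ) per step, so replacing it by its
initial value over j steps costs O((jδ)²). This estimate lets the equation itself pass to the limit.
-/
lemma abs_meshScheme_sub_sub_le {T D E : ℝ} {N : ℕ}
    (hD : ∀ n : ℕ, n * timeStep g K N ≤ T → ∀ x, |meshScheme g K f N n x| ≤ D)
    (hD1 : ∀ n : ℕ, n * timeStep g K N ≤ T → ∀ x, |deriv (meshScheme g K f N n) x| ≤ D)
    (hE : ∀ n : ℕ, n * timeStep g K N ≤ T → ∀ x, |discreteRate g K (meshSize N)
      (meshScheme g K f N n) (meshScheme g K f N n) x| ≤ E)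
    (hE1 : ∀ n : ℕ, n * timeStep g K N ≤ T → ∀ x, |deriv (discreteRate g K (meshSize N)
      (meshScheme g K f N n) (meshScheme g K f N n)) x| ≤ E)
    (n j : ℕ) (hn : ((n + j : ℕ) : ℝ) * timeStep g K N ≤ T) (x : ℝ) :
    |meshScheme g K f N (n + j) x - meshScheme g K f N n x - j * timeStep g K N *
      discreteRate g K (meshSize N) (meshScheme g K f N n) (meshScheme g K f N n) x| ≤
      (2 * D * E + K * E + 3 * E * kernelMass g) * (j * timeStep g K N) ^ 2 := by
  have hδ := hd.timeStep_pos N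
  set A := 2 * D * E + K * E + 3 * E * kernelMass g with hA
  set F : ℕ → ℝ := fun n => discreteRate g K (meshSize N) (meshScheme g K f N n)
    (meshScheme g K f N n) x with hF
  have hK := hd.K_nonneg
  have hG := hd.levy.kernelMass_nonneg
  have hn0 : (n : ℝ) * timeStep g K N ≤ T := by
    refine le_trans ?_ hn
    push_cast
    nlinarith [mul_nonneg (Nat.cast_nonneg (α := ℝ) j) hδ.le]
  have hD0 : 0 ≤ D := (abs_nonneg _).trans (hD n hn0 0)
  have hE0 : 0 ≤ E := (abs_nonneg _).trans (hE n hn0 0)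
  have hA0 : 0 ≤ A := by positivity
  have step : ∀ i : ℕ, ((n + i : ℕ) : ℝ) * timeStep g K N ≤ T →
      |F (n + i) - F n| ≤ A * (i * timeStep g K N) := by
    intro i hi
    induction i with
    | zero => simp
    | succ i ih =>
      have hi' : ((n + i : ℕ) : ℝ) * timeStep g K N ≤ T := by push_cast at hi ⊢; nlinarith
      have e : meshScheme g K f N (n + (i + 1)) =
        eulerStep g K (meshSize N) (timeStep g K N) (meshScheme g K f N (n + i)) :=
        funext fun x => meshScheme_succ g K f N (n + i) x
      have h1 := (hd.cfl N).abs_discreteRate_eulerStep_sub_le (hd.smooth_meshScheme N (n + i))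
        (hD1 _ hi') (by rw [← e]; exact hD _ hi) (hE _ hi') (hE1 _ hi') x
      rw [← e] at h1
      change |F (n + (i + 1)) - F (n + i)| ≤ _ at h1
      have := abs_sub_le (F (n + (i + 1))) (F (n + i)) (F n)
      have := ih hi'
      push_cast
      linarith
  induction j with
  | zero => simp
  | succ j ih =>
    have hj' : ((n + j : ℕ) : ℝ) * timeStep g K N ≤ T := by push_cast at hn ⊢; nlinarith
    have ih := ih hj'
    have e := meshScheme_succ g K f N (n + j) x
    have s := step j hj'
    change |_ - _ - _ * F n| ≤ _ at ih ⊢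
    change meshScheme g K f N (n + (j + 1)) x = _ + _ * F (n + j) at e
    rw [e]
    push_cast
    rw [show meshScheme g K f N (n + j) x + timeStep g K N * F (n + j) -
      meshScheme g K f N n x - (j + 1) * timeStep g K N * F n =
      (meshScheme g K f N (n + j) x - meshScheme g K f N n x - j * timeStep g K N * F n) +
      timeStep g K N * (F (n + j) - F n) by ring]
    refine (abs_add_le _ _).trans ?_
    rw [abs_mul, abs_of_pos hδ]
    have := mul_le_mul_of_nonneg_left s hδ.le
    nlinarith [mul_nonneg hA0 (sq_nonneg (timeStep g K N)),
      mul_nonneg (mul_nonneg hA0 (sq_nonneg (timeStep g K N))) (Nat.cast_nonneg (α := ℝ) j)]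

/-- The limit solves the equation up to quadratic errors in time. -/
lemma burgersLimit_quadratic {T : ℝ} (hT : SlopeControlled g K f T) :
    ∃ C, ∀ s ∈ Icc 0 T, ∀ t ∈ Icc 0 T, s ≤ t → ∀ x,
      |burgersLimit g K f t x - burgersLimit g K f s x -
        (t - s) * burgersRate g (burgersLimit g K f s) x| ≤ C * (t - s) ^ 2 := by
  obtain ⟨D, hD0, hD⟩ := hd.exists_bound hT
  set R : ℕ → ℝ → ℝ := fun k d => (1 + 2 ^ k) * d ^ 2 + K * d + 3 * d * kernelMass g with hR
  set E := max (R 0 (D 1)) (R 1 (D 2)) with hE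
  refine ⟨2 * D 1 * E + K * E + 3 * E * kernelMass g, fun s hs t ht hst x => ?_⟩
  have l0 : ∀ t ∈ Icc 0 T, Tendsto (fun N => approx g K f t N x) (hyperfilter ℕ)
      (𝓝 (burgersLimit g K f t x)) := fun t ht => by
    simpa using (hd.smooth_burgersLimit hT ht).2 0 x
  have lr : Tendsto (fun N => discreteRate g K (meshSize N) (approx g K f s N) (approx g K f s N) x)
      (hyperfilter ℕ) (𝓝 (burgersRate g (burgersLimit g K f s) x)) :=
    tendsto_discreteRate hd.levy hd.period_pos hd.K_nonneg meshSize_pos tendsto_meshSize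
      (fun N => hd.smooth_meshScheme N _) (fun N => periodic_scheme hd.periodic _)
      (hd.eventually_approx_bound hD hs) x
  have lt := (hd.tendsto_floor_mul ht.1).sub (hd.tendsto_floor_mul hs.1)
  refine le_of_tendsto_of_tendsto (((l0 t ht).sub (l0 s hs)).sub (lt.mul lr)).abs
    ((lt.pow 2).const_mul _) ?_
  filter_upwards [hD 1, hD 2] with N h1 h2
  obtain ⟨j, hj, hj'⟩ := hd.exists_floor_eq_add hst N
  rw [← hj', approx, approx, hj]
  refine hd.abs_meshScheme_sub_sub_le (T := T) (fun n hn x => by simpa using h1 n hn 0 (by simp) x)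
    (fun n hn x => by simpa [iteratedDeriv_one] using h1 n hn 1 le_rfl x)
    (fun n hn x => ?_) (fun n hn x => ?_) _ j
    (by rw [← hj]; exact (hd.floor_mul_le ht.1 N).trans ht.2) x
  · have := (hd.cfl N).abs_iteratedDeriv_discreteRate_le (hd.smooth_meshScheme N n) (k := 0)
      (h1 n hn) x
    rw [iteratedDeriv_zero] at this
    exact this.trans (le_max_left _ _)
  · have := (hd.cfl N).abs_iteratedDeriv_discreteRate_le (hd.smooth_meshScheme N n) (k := 1)
      (h2 n hn) x
    rw [iteratedDeriv_one] at this
    exact this.trans (le_max_right _ _)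

/-- A slope bound at one time controls the slopes for a while. -/
lemma slopeControlled_add {t B : ℝ} (ht : 0 ≤ t) (hT : SlopeControlled g K f t)
    (hB : ∀ x, |deriv (burgersLimit g K f t) x| ≤ B) :
    SlopeControlled g K f (t + 1 / (16 * (B + 1))) := by
  have hB0 : 0 ≤ B := (abs_nonneg _).trans (hB 0)
  have htt : t ∈ Icc 0 t := ⟨ht, le_rfl⟩
  obtain ⟨D, hD0, hD⟩ := hd.exists_bound hT
  obtain ⟨hsm, hlim⟩ := hd.smooth_burgersLimit hT htt
  obtain ⟨B₁, hB₁, hT'⟩ := hT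
  have hbd := hd.eventually_approx_bound hD htt
  have lipN : ∀ᶠ N in (hyperfilter ℕ : Filter ℕ), ∀ x y,
      |deriv (approx g K f t N) x - deriv (approx g K f t N) y| ≤ D 2 * |x - y| := by
    filter_upwards [hbd 2] with N hN
    have := (hd.smooth_meshScheme N _).lipschitz_iteratedDeriv (k := 1) hN
    rwa [iteratedDeriv_one] at this
  have lim1 : ∀ x, Tendsto (fun N => deriv (approx g K f t N) x) (hyperfilter ℕ)
      (𝓝 (deriv (burgersLimit g K f t) x)) := by
    simpa [iteratedDeriv_one] using hlim 1
  have perd : ∀ {u : ℝ → ℝ}, Function.Periodic u ℓ → Function.Periodic (deriv u) ℓ := by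
    intro u hu x
    rw [← deriv_comp_add_const, hu.funext]
  -- The discrete slopes at time t are eventually within 1 of those of the limit, uniformly in x, so
  -- B + 1 bounds them.
  have hun := eventually_abs_sub_le_of_periodic hd.period_pos one_pos
    (fun N => perd (periodic_scheme hd.periodic _)) (perd (hd.periodic_burgersLimit t)) lipN
    (fun x y => le_of_tendsto ((lim1 x).sub (lim1 y)).abs (lipN.mono fun N hN => hN x y)) lim1
  -- Restarted from slope B + 1, the discrete Riccati bound lasts for time 1/(8(B+1)) = 2c. Half of
  -- it is kept in reserve for rounding t down to a multiple of the time step, which is eventually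
  -- less than c.
  set c := 1 / (16 * (B + 1)) with hc
  have hc0 : 0 < c := by positivity
  refine ⟨max B₁ (2 * (B + 1)), hB₁.trans (le_max_left _ _), ?_⟩
  filter_upwards [hun, hT', hd.tendsto_timeStep.eventually (gt_mem_nhds hc0)] with N h1 h2 h3 n hn x
  rcases le_total n ⌊t / timeStep g K N⌋₊ with hnt | hnt
  · refine (h2 n (le_trans ?_ (hd.floor_mul_le ht N)) x).trans (le_max_left _ _)
    exact mul_le_mul_of_nonneg_right (by exact_mod_cast hnt) (hd.timeStep_pos N).le
  · obtain ⟨j, rfl⟩ := Nat.exists_eq_add_of_le hnt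
    refine le_trans ?_ (le_max_right _ _)
    rw [meshScheme, scheme_add]
    refine (hd.cfl N).abs_deriv_scheme_le (hd.smooth_meshScheme N _)
      ((hd.cfl N).abs_scheme_le hd.smooth hd.abs_le _) (fun y => ?_) j ?_ x
    · have : |deriv (approx g K f t N) y - deriv (burgersLimit g K f t) y| ≤ 1 := h1 y
      have h5 := hB y
      have h4 := abs_add_le (deriv (approx g K f t N) y - deriv (burgersLimit g K f t) y)
        (deriv (burgersLimit g K f t) y)
      rw [sub_add_cancel] at h4
      exact h4.trans (by linarith)
    · have h6 := hd.lt_floor_mul_add t N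
      push_cast at hn
      have h7 : (j : ℝ) * timeStep g K N ≤ 2 * c := by linarith
      calc 8 * (B + 1) * (j * timeStep g K N) ≤ 8 * (B + 1) * (2 * c) :=
            mul_le_mul_of_nonneg_left h7 (by positivity)
        _ = 1 := by rw [hc]; field_simp; norm_num
        _ ≤ 1 := le_rfl

/-- At T = 0 only the initial datum is tested, since the time step is positive; continuation from
there gives a positive time. -/
lemma exists_slopeControlled : ∃ T, 0 < T ∧ SlopeControlled g K f T := by
  have h0 : SlopeControlled g K f 0 := by
    obtain ⟨B, hB⟩ := hd.smooth.deriv.bdd_zero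
    refine ⟨B, (abs_nonneg _).trans (hB 0), Eventually.of_forall fun N n hn x => ?_⟩
    have hδ := hd.timeStep_pos N
    obtain rfl : n = 0 := by
      by_contra h
      have : (0 : ℝ) < n := by exact_mod_cast Nat.pos_of_ne_zero h
      nlinarith [mul_pos this hδ]
    exact hB x
  obtain ⟨B, hB⟩ := hd.smooth.deriv.bdd_zero
  have hB0 : 0 ≤ B := (abs_nonneg _).trans (hB 0)
  exact ⟨_, by positivity, hd.slopeControlled_add le_rfl h0 (by rwa [burgersLimit_zero])⟩

end OddDatum

/-! ### Finite-time breakdown -/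

section functional

variable {f : ℝ → ℝ} {ℓ K : ℝ}

lemma integral_period_eq_zero_of_odd (hper : Function.Periodic f ℓ) (hodd : ∀ x, f (-x) = -f x) :
    ∫ x in (0 : ℝ)..ℓ, f x = 0 := by
  have h1 := hper.intervalIntegral_add_eq (-(ℓ / 2)) 0
  rw [zero_add, show -(ℓ / 2) + ℓ = ℓ / 2 by ring] at h1
  rw [← h1]
  have h2 : ∫ x in (-(ℓ / 2))..(ℓ / 2), f (-x) = ∫ x in (-(ℓ / 2))..(ℓ / 2), f x := by
    rw [intervalIntegral.integral_comp_neg, neg_neg]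
  simp only [hodd, intervalIntegral.integral_neg] at h2
  linarith

lemma periodic_primitive (hf : Continuous f) (hper : Function.Periodic f ℓ)
    (hodd : ∀ x, f (-x) = -f x) : Function.Periodic (fun y => ∫ x in (0 : ℝ)..y, f x) ℓ := by
  intro y
  have h1 := hper.intervalIntegral_add_eq y 0
  rw [zero_add, integral_period_eq_zero_of_odd hper hodd] at h1
  have h2 := intervalIntegral.integral_add_adjacent_intervals
    (hf.intervalIntegrable (μ := volume) 0 y) (hf.intervalIntegrable (μ := volume) y (y + ℓ))
  simp only
  linarith

lemma abs_primitive_le (hK : ∀ x, |f x| ≤ K) (y : ℝ) : |∫ x in (0 : ℝ)..y, f x| ≤ K * |y| := by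
  have := intervalIntegral.norm_integral_le_of_norm_le_const (a := 0) (b := y) (f := f) (C := K)
    (fun x _ => hK x)
  simpa using this

/-- Near 0 the primitive grows at most linearly. Far away it equals its value at a point of one
period, because an odd periodic function has mean zero. This is exactly the weight against which the
kernel is integrable. -/
lemma abs_primitive_le_min (hℓ : 0 < ℓ) (hf : Continuous f) (hper : Function.Periodic f ℓ)
    (hodd : ∀ x, f (-x) = -f x) (hK : ∀ x, |f x| ≤ K) (y : ℝ) :
    |∫ x in (0 : ℝ)..y, f x| ≤ (1 + ℓ) * K * min 1 |y| := by
  have hK0 : 0 ≤ K := (abs_nonneg _).trans (hK 0)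
  rcases le_total 1 |y| with h | h
  · rw [min_eq_left h]
    obtain ⟨z, hz, hyz⟩ := (periodic_primitive hf hper hodd).exists_mem_Ico₀ hℓ y
    rw [hyz]
    refine (abs_primitive_le hK z).trans ?_
    rw [abs_of_nonneg hz.1]
    nlinarith [hz.2]
  · rw [min_eq_right h]
    refine (abs_primitive_le hK y).trans ?_
    nlinarith [mul_nonneg (mul_nonneg hℓ.le hK0) (abs_nonneg y)]

/-- Integration by parts with the primitive P. The interior term is the integral of P minus a
translate over a full period, hence zero. Only the jump ℓ of the sawtooth across a period remains,
multiplied by P(y). -/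
lemma integral_sub_translate_mul (hf : Continuous f) (hper : Function.Periodic f ℓ)
    (hodd : ∀ x, f (-x) = -f x) (y : ℝ) :
    ∫ x in (0 : ℝ)..ℓ, (f x - f (x + y)) * (ℓ / 2 - x) = ℓ * ∫ x in (0 : ℝ)..y, f x := by
  set P : ℝ → ℝ := fun y => ∫ x in (0 : ℝ)..y, f x with hP
  have dP : ∀ x, HasDerivAt P (f x) x := fun x =>
    intervalIntegral.integral_hasDerivAt_right (hf.intervalIntegrable _ _)
      (hf.stronglyMeasurableAtFilter _ _) hf.continuousAt
  have cP : Continuous P := continuous_iff_continuousAt.2 fun x => (dP x).continuousAt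
  have hPp : Function.Periodic P ℓ := periodic_primitive hf hper hodd
  have P0 : P 0 = 0 := by simp [hP]
  have d : ∀ x ∈ uIcc 0 ℓ, HasDerivAt (fun x => (P x - P (x + y)) * (ℓ / 2 - x))
      ((f x - f (x + y)) * (ℓ / 2 - x) - (P x - P (x + y))) x := fun x _ => by
    have h1 := (dP x).sub ((dP (x + y)).comp_add_const x y)
    have h2 := (hasDerivAt_id x).const_sub (ℓ / 2)
    refine (h1.mul h2).congr_deriv ?_
    simp only [Pi.sub_apply, id]
    ring
  have key := intervalIntegral.integral_eq_sub_of_hasDerivAt d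
    (Continuous.intervalIntegrable (by fun_prop) _ _)
  rw [intervalIntegral.integral_sub (Continuous.intervalIntegrable (by fun_prop) _ _)
    (Continuous.intervalIntegrable (by fun_prop) _ _), intervalIntegral.integral_sub
    (Continuous.intervalIntegrable (by fun_prop) _ _)
    (Continuous.intervalIntegrable (by fun_prop) _ _),
    intervalIntegral.integral_comp_add_right] at key
  have h3 := hPp.intervalIntegral_add_eq y 0
  have e1 : P ℓ = 0 := by simpa [P0] using hPp 0
  have e2 : P (ℓ + y) = P y := by rw [add_comm]; exact hPp y
  rw [zero_add] at h3
  rw [zero_add, add_comm ℓ y, h3, add_comm y ℓ, e1, e2, P0] at key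
  change _ = ℓ * P y
  linear_combination key

lemma integral_mul_deriv_mul (hf : SmoothBdd f) (hper : Function.Periodic f ℓ) (h0 : f 0 = 0) :
    ∫ x in (0 : ℝ)..ℓ, f x * deriv f x * (ℓ / 2 - x) = (∫ x in (0 : ℝ)..ℓ, f x ^ 2) / 2 := by
  have c0 := hf.continuous
  have c1 := hf.deriv.continuous
  have d : ∀ x ∈ uIcc 0 ℓ, HasDerivAt (fun x => f x ^ 2 / 2 * (ℓ / 2 - x))
      (f x * deriv f x * (ℓ / 2 - x) - f x ^ 2 / 2) x := fun x _ => by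
    have h1 := ((hf.hasDerivAt x).pow 2).div_const 2
    have h2 := (hasDerivAt_id x).const_sub (ℓ / 2)
    refine (h1.mul h2).congr_deriv ?_
    simp only [id, Pi.pow_apply]
    push_cast
    ring
  have key := intervalIntegral.integral_eq_sub_of_hasDerivAt d
    (Continuous.intervalIntegrable (by fun_prop) _ _)
  have e1 : f ℓ = 0 := by rw [← h0]; simpa using hper 0
  rw [intervalIntegral.integral_sub (Continuous.intervalIntegrable (by fun_prop) _ _)
    (Continuous.intervalIntegrable (by fun_prop) _ _), intervalIntegral.integral_div, e1, h0] at key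
  linarith

/-- Fubini reduces the claim to `integral_sub_translate_mul` for each y. The double integral
converges absolutely by the same `min 1 |y|` bound that defines ℒ f. -/
lemma integral_Lop_mul {g : ℝ → ℝ} (hg : LevyKernel g) (hℓ : 0 < ℓ) (hf : SmoothBdd f)
    (hper : Function.Periodic f ℓ) (hodd : ∀ x, f (-x) = -f x) :
    ∫ x in (0 : ℝ)..ℓ, Lop g f x * (ℓ / 2 - x) = ∫ y, ℓ * (∫ x in (0 : ℝ)..y, f x) * g y := by
  obtain ⟨B₀, h0⟩ := hf.bdd_zero
  obtain ⟨B₁, h1⟩ := hf.lipschitz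
  have c0 := hf.continuous
  have hB : 0 ≤ 2 * B₀ + B₁ := by
    have a1 := (abs_nonneg _).trans (h0 0)
    have a2 := (abs_nonneg _).trans (h1 1 0)
    simp only [sub_zero, abs_one, mul_one] at a2
    linarith
  have int : Integrable (Function.uncurry fun x y : ℝ => (f x - f (x + y)) * g y * (ℓ / 2 - x))
      ((volume.restrict (Ioc 0 ℓ)).prod volume) := by
    have hb : Integrable (fun z : ℝ × ℝ => ((2 * B₀ + B₁) * ℓ) * (min 1 |z.2| * g z.2))
        ((volume.restrict (Ioc 0 ℓ)).prod volume) :=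
      (integrable_const ((2 * B₀ + B₁) * ℓ)).mul_prod hg.int
    refine hb.mono' ?_ ?_
    · refine AEStronglyMeasurable.mul (AEStronglyMeasurable.mul
        (Continuous.aestronglyMeasurable (by fun_prop)) hg.meas.comp_snd)
        (Continuous.aestronglyMeasurable (by fun_prop))
    · have : ∀ᵐ z : ℝ × ℝ ∂((volume.restrict (Ioc 0 ℓ)).prod volume), z.1 ∈ Ioc 0 ℓ :=
        Measure.quasiMeasurePreserving_fst.ae (ae_restrict_mem measurableSet_Ioc)
      filter_upwards [this] with z hz
      have a1 : |ℓ / 2 - z.1| ≤ ℓ := abs_le.2 ⟨by linarith [hz.2], by linarith [hz.1]⟩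
      have a2 := abs_sub_add_le_min h0 h1 z.1 z.2
      have a3 := hg.nonneg z.2
      simp only [Function.uncurry, Real.norm_eq_abs, abs_mul, abs_of_nonneg a3]
      calc _ ≤ ((2 * B₀ + B₁) * min 1 |z.2|) * g z.2 * ℓ := by
            refine mul_le_mul (mul_le_mul_of_nonneg_right a2 a3) a1 (abs_nonneg _) ?_
            exact mul_nonneg (mul_nonneg hB (le_min zero_le_one (abs_nonneg _))) a3
        _ = _ := by ring
  calc ∫ x in (0 : ℝ)..ℓ, Lop g f x * (ℓ / 2 - x)
      = ∫ x in Ioc 0 ℓ, ∫ y, (f x - f (x + y)) * g y * (ℓ / 2 - x) := by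
        rw [intervalIntegral.integral_of_le hℓ.le]
        simp only [Lop, integral_mul_const]
    _ = ∫ y, ∫ x in Ioc 0 ℓ, (f x - f (x + y)) * g y * (ℓ / 2 - x) :=
        integral_integral_swap int
    _ = _ := by
        congr 1
        funext y
        rw [← integral_sub_translate_mul c0 hper hodd y, ← intervalIntegral.integral_of_le hℓ.le,
          ← intervalIntegral.integral_mul_const]
        congr 1
        funext x
        ring

lemma abs_integral_Lop_mul_le {g : ℝ → ℝ} (hg : LevyKernel g) (hℓ : 0 < ℓ) (hf : SmoothBdd f)
    (hper : Function.Periodic f ℓ) (hodd : ∀ x, f (-x) = -f x) (hK : ∀ x, |f x| ≤ K) :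
    |∫ x in (0 : ℝ)..ℓ, Lop g f x * (ℓ / 2 - x)| ≤ ℓ * (1 + ℓ) * K * kernelMass g := by
  rw [integral_Lop_mul hg hℓ hf hper hodd, kernelMass, ← integral_const_mul, ← Real.norm_eq_abs]
  refine norm_integral_le_of_norm_le (hg.int.const_mul _) (ae_of_all _ fun y => ?_)
  rw [Real.norm_eq_abs, abs_mul, abs_mul, abs_of_nonneg (hg.nonneg y), abs_of_pos hℓ]
  have := mul_le_mul_of_nonneg_left (abs_primitive_le_min hℓ hf.continuous hper hodd hK y) hℓ.le
  calc _ ≤ _ := mul_le_mul_of_nonneg_right this (hg.nonneg y)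
    _ = _ := by ring

/-- The functional `∫ f(x) (ℓ/2 - x) dx` grows quadratically along the flow. -/
lemma le_integral_burgersRate_mul {g : ℝ → ℝ} (hg : LevyKernel g) (hℓ : 0 < ℓ) (hf : SmoothBdd f)
    (hper : Function.Periodic f ℓ) (hodd : ∀ x, f (-x) = -f x) (hK : ∀ x, |f x| ≤ K) (c : ℝ) :
    c * (∫ x in (0 : ℝ)..ℓ, f x * (ℓ / 2 - x)) - c ^ 2 * (ℓ ^ 3 / 12) / 2 -
      ℓ * (1 + ℓ) * K * kernelMass g ≤ ∫ x in (0 : ℝ)..ℓ, burgersRate g f x * (ℓ / 2 - x) := by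
  have c0 := hf.continuous
  have c1 := hf.deriv.continuous
  have c2 := (hf.Lop hg).continuous
  have f0 : f 0 = 0 := by
    have := hodd 0
    rw [neg_zero] at this
    linarith
  have e : ∫ x in (0 : ℝ)..ℓ, burgersRate g f x * (ℓ / 2 - x) =
      (∫ x in (0 : ℝ)..ℓ, f x ^ 2) / 2 - ∫ x in (0 : ℝ)..ℓ, Lop g f x * (ℓ / 2 - x) := by
    rw [← integral_mul_deriv_mul hf hper f0, ← intervalIntegral.integral_sub
      (Continuous.intervalIntegrable (by fun_prop) _ _)
      (Continuous.intervalIntegrable (by fun_prop) _ _)]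
    simp only [burgersRate, sub_mul]
  have h1 := (abs_le.1 (abs_integral_Lop_mul_le hg hℓ hf hper hodd hK)).2
  have w2 : ∫ x in (0 : ℝ)..ℓ, (ℓ / 2 - x) ^ 2 = ℓ ^ 3 / 12 := by
    rw [intervalIntegral.integral_comp_sub_left (fun x => x ^ 2), integral_pow]
    push_cast
    ring
  -- Cauchy–Schwarz in linearized form: expanding the square bounds ∫f² from below by an expression
  -- linear in the moment, with `c` still free.
  have sq : 0 ≤ ∫ x in (0 : ℝ)..ℓ, (f x - c * (ℓ / 2 - x)) ^ 2 :=
    intervalIntegral.integral_nonneg hℓ.le fun x _ => sq_nonneg _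
  have sq' : ∫ x in (0 : ℝ)..ℓ, (f x - c * (ℓ / 2 - x)) ^ 2 = (∫ x in (0 : ℝ)..ℓ, f x ^ 2) -
      2 * c * (∫ x in (0 : ℝ)..ℓ, f x * (ℓ / 2 - x)) + c ^ 2 * (ℓ ^ 3 / 12) := by
    rw [← w2, ← intervalIntegral.integral_const_mul, ← intervalIntegral.integral_const_mul,
      ← intervalIntegral.integral_sub (Continuous.intervalIntegrable (by fun_prop) _ _)
      (Continuous.intervalIntegrable (by fun_prop) _ _), ← intervalIntegral.integral_add
      (Continuous.intervalIntegrable (by fun_prop) _ _)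
      (Continuous.intervalIntegrable (by fun_prop) _ _)]
    congr 1
    funext x
    ring
  rw [e]
  rw [sq'] at sq
  linarith

lemma abs_integral_mul_le (hℓ : 0 < ℓ) {u : ℝ → ℝ} {M : ℝ} (hu : ∀ x, |u x| ≤ M) :
    |∫ x in (0 : ℝ)..ℓ, u x * (ℓ / 2 - x)| ≤ M * ℓ ^ 2 := by
  have := intervalIntegral.norm_integral_le_of_norm_le_const (a := 0) (b := ℓ)
    (f := fun x => u x * (ℓ / 2 - x)) (C := M * ℓ) (fun x hx => by
      rw [uIoc_of_le hℓ.le] at hx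
      rw [Real.norm_eq_abs, abs_mul]
      exact mul_le_mul (hu x) (abs_le.2 ⟨by linarith [hx.2], by linarith [hx.1]⟩) (abs_nonneg _)
        ((abs_nonneg _).trans (hu x)))
  rw [Real.norm_eq_abs, sub_zero, abs_of_pos hℓ] at this
  refine this.trans (le_of_eq ?_)
  ring

end functional

namespace OddDatum

variable {g : ℝ → ℝ} {K ℓ : ℝ} {f : ℝ → ℝ} (hd : OddDatum g K ℓ f)
include hd

/-- Slopes cannot stay controlled for a long time if the datum is large. -/
lemma le_of_slopeControlled {T J : ℝ} (hJ : J = ∫ x in (0 : ℝ)..ℓ, f x * (ℓ / 2 - x)) (hJ0 : 0 < J)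
    (hbig : ℓ * (1 + ℓ) * K * kernelMass g + 1 < J ^ 2 / (2 * (ℓ ^ 3 / 12)))
    (hT : SlopeControlled g K f T) : T ≤ K * ℓ ^ 2 := by
  have hℓ := hd.period_pos
  rcases lt_or_ge T 0 with hT0 | hT0
  · exact hT0.le.trans (mul_nonneg hd.K_nonneg (sq_nonneg ℓ))
  obtain ⟨C₁, hC₁, lip⟩ := hd.lipschitz_burgersLimit hT 0
  obtain ⟨C₂, quad⟩ := hd.burgersLimit_quadratic hT
  simp only [iteratedDeriv_zero] at lip
  set θ := burgersLimit g K f with hθ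
  have sm : ∀ t ∈ Icc 0 T, SmoothBdd (θ t) := fun t ht => (hd.smooth_burgersLimit hT ht).1
  set I : ℝ → ℝ := fun t => ∫ x in (0 : ℝ)..ℓ, θ t x * (ℓ / 2 - x) with hI
  set I' : ℝ → ℝ := fun t => ∫ x in (0 : ℝ)..ℓ, burgersRate g (θ t) x * (ℓ / 2 - x) with hI'
  have iθ : ∀ t ∈ Icc 0 T, IntervalIntegrable (fun x => θ t x * (ℓ / 2 - x)) volume 0 ℓ :=
    fun t ht => by
      have := (sm t ht).continuous
      exact Continuous.intervalIntegrable (by fun_prop) _ _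
  have ir : ∀ t ∈ Icc 0 T, IntervalIntegrable (fun x => burgersRate g (θ t) x * (ℓ / 2 - x))
      volume 0 ℓ := fun t ht => by
    have c0 := (sm t ht).continuous
    have c1 := (sm t ht).deriv.continuous
    have c2 := ((sm t ht).Lop hd.levy).continuous
    unfold burgersRate
    exact Continuous.intervalIntegrable (by fun_prop) _ _
  have Ilip : ∀ s ∈ Icc 0 T, ∀ t ∈ Icc 0 T, s ≤ t → |I t - I s| ≤ C₁ * ℓ ^ 2 * (t - s) := by
    intro s hs t ht hst
    have := abs_integral_mul_le hℓ (u := fun x => θ t x - θ s x) (lip s hs t ht hst)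
    simp only [hI]
    rw [← intervalIntegral.integral_sub (iθ t ht) (iθ s hs)]
    simp only [← sub_mul]
    refine this.trans (le_of_eq ?_)
    ring
  have Iquad : ∀ s ∈ Icc 0 T, ∀ t ∈ Icc 0 T, s ≤ t →
      |I t - I s - (t - s) * I' s| ≤ C₂ * ℓ ^ 2 * (t - s) ^ 2 := by
    intro s hs t ht hst
    have := abs_integral_mul_le hℓ (u := fun x => θ t x - θ s x - (t - s) * burgersRate g (θ s) x)
      (quad s hs t ht hst)
    simp only [hI, hI']
    rw [← intervalIntegral.integral_sub (iθ t ht) (iθ s hs), ← intervalIntegral.integral_const_mul,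
      ← intervalIntegral.integral_sub ((iθ t ht).sub (iθ s hs)) ((ir s hs).const_mul _)]
    simp only [← sub_mul, ← mul_assoc]
    refine this.trans (le_of_eq ?_)
    ring
  have Icont : ContinuousOn I (Icc 0 T) := by
    have : LipschitzOnWith (Real.toNNReal (C₁ * ℓ ^ 2)) I (Icc 0 T) := by
      refine LipschitzOnWith.of_dist_le_mul fun t ht s hs => ?_
      rw [Real.coe_toNNReal _ (by positivity), Real.dist_eq, Real.dist_eq]
      rcases le_total s t with h | h
      · rw [abs_of_nonneg (sub_nonneg.2 h)]; exact Ilip s hs t ht h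
      · rw [abs_sub_comm (I t), abs_sub_comm t, abs_of_nonneg (sub_nonneg.2 h)]
        exact Ilip t ht s hs h
    exact this.continuousOn
  -- The quadratic estimate is only forward in time, so it yields right derivatives; these suffice
  -- for the comparison below.
  have Ider : ∀ t ∈ Ico 0 T, HasDerivWithinAt I (I' t) (Ici t) t := by
    intro t ht
    have : HasDerivWithinAt I (I' t) (Icc t T) t :=
      hasDerivWithinAt_of_quadratic fun s hs => Iquad t (Ico_subset_Icc_self ht) s
        ⟨ht.1.trans hs.1, hs.2⟩ hs.1
    exact this.mono_of_mem_nhdsWithin (Icc_mem_nhdsGE ht.2)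
  have I0 : I 0 = J := by simp only [hI, hJ, hθ, burgersLimit_zero]
  -- Comparison of I with J + t, in negated form: it is enough that I' > 1 at every time where the
  -- two coincide.
  have hcomp := image_le_of_deriv_right_lt_deriv_boundary' (f := fun t => -I t)
    (f' := fun t => -I' t) (a := 0) (b := T) Icont.neg (fun t ht => (Ider t ht).neg)
    (B := fun t => -(J + t)) (B' := fun _ => -1) (by simp [I0]) (by fun_prop)
    (fun t _ => (((hasDerivAt_id t).const_add J).neg).hasDerivWithinAt) (fun t ht he => ?_)
  · have h1 := hcomp (right_mem_Icc.2 hT0)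
    have h2 := (_root_.abs_le.1 (abs_integral_mul_le hℓ (hd.abs_burgersLimit_le T))).2
    change I T ≤ _ at h2
    linarith
  · simp only [neg_inj, neg_lt_neg_iff] at he ⊢
    have ht' := Ico_subset_Icc_self ht
    -- The choice c = J/W is optimal at I = J. When I = J + t the bound only improves, by (J/W)t ≥
    -- 0.
    have h1 := le_integral_burgersRate_mul hd.levy hℓ (sm t ht') (hd.periodic_burgersLimit t)
      (hd.burgersLimit_odd t) (hd.abs_burgersLimit_le t) (J / (ℓ ^ 3 / 12))
    change _ * I t - _ - _ ≤ I' t at h1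
    rw [he] at h1
    set W := ℓ ^ 3 / 12 with hW
    have hW0 : 0 < W := by positivity
    have e1 : J / W * (J + t) - (J / W) ^ 2 * W / 2 = J ^ 2 / (2 * W) + J / W * t := by
      field_simp; ring
    have e2 : 0 ≤ J / W * t := mul_nonneg (by positivity) ht.1
    linarith

end OddDatum

/-! ### The datum -/

lemma integral_sin_mul {ℓ : ℝ} (hℓ : 0 < ℓ) (A : ℝ) :
    ∫ x in (0 : ℝ)..ℓ, A * Real.sin (2 * Real.pi / ℓ * x) * (ℓ / 2 - x) =
      A * (ℓ ^ 2 / (2 * Real.pi)) := by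
  have hπ := Real.pi_pos
  set k := 2 * Real.pi / ℓ with hk
  have hk0 : 0 < k := by positivity
  have hkℓ : k * ℓ = 2 * Real.pi := by rw [hk]; field_simp
  have d : ∀ x ∈ uIcc 0 ℓ, HasDerivAt
      (fun x => A * (-(Real.cos (k * x) / k) * (ℓ / 2 - x) - Real.sin (k * x) / k ^ 2))
      (A * Real.sin (k * x) * (ℓ / 2 - x)) x := fun x _ => by
    have h0 : HasDerivAt (fun x => k * x) k x := by
      simpa using (hasDerivAt_id x).const_mul k
    have h1 := (h0.cos.div_const k).neg
    have h2 := (hasDerivAt_id x).const_sub (ℓ / 2)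
    have h3 := h0.sin.div_const (k ^ 2)
    refine (((h1.mul h2).sub h3).const_mul A).congr_deriv ?_
    simp only [id, Pi.neg_apply]
    field_simp
    ring
  rw [intervalIntegral.integral_eq_sub_of_hasDerivAt d
    (Continuous.intervalIntegrable (by fun_prop) _ _), hkℓ]
  simp only [Real.cos_two_pi, Real.sin_two_pi, mul_zero, Real.cos_zero, Real.sin_zero]
  have : ℓ ^ 2 / (2 * Real.pi) = ℓ / k := by rw [hk]; field_simp
  rw [this]
  field_simp
  ring

lemma SmoothBdd.of_periodic {f : ℝ → ℝ} {ℓ : ℝ} (hf : ContDiff ℝ ∞ f) (hℓ : 0 < ℓ)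
    (hper : Function.Periodic f ℓ) : SmoothBdd f where
  smooth := hf
  bdd k := by
    have hp : Function.Periodic (_root_.iteratedDeriv k f) ℓ := fun x => by
      rw [← iteratedDeriv_comp_add, hper.funext]
    obtain ⟨B, hB⟩ := (hp.isBounded_of_continuous hℓ.ne'
      (hf.continuous_iteratedDeriv k (by exact_mod_cast le_top))).exists_norm_le
    exact ⟨B, fun x => hB _ (mem_range_self x)⟩

lemma oddDatum_sin {g : ℝ → ℝ} (hg : LevyKernel g) {ℓ A : ℝ} (hℓ : 0 < ℓ) (hA : 0 ≤ A) :
    OddDatum g A ℓ (fun x => A * Real.sin (2 * Real.pi / ℓ * x)) where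
  levy := hg
  period_pos := hℓ
  smooth := by
    refine SmoothBdd.const_mul A (SmoothBdd.of_periodic (ℓ := ℓ)
      (Real.contDiff_sin.comp (contDiff_const.mul contDiff_id)) hℓ fun x => ?_)
    have : 2 * Real.pi / ℓ * (x + ℓ) = 2 * Real.pi / ℓ * x + 2 * Real.pi := by field_simp
    simp only [this, Real.sin_add_two_pi]
  periodic x := by
    have : 2 * Real.pi / ℓ * (x + ℓ) = 2 * Real.pi / ℓ * x + 2 * Real.pi := by field_simp
    simp only [this, Real.sin_add_two_pi]
  odd x := by simp
  abs_le x := by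
    rw [abs_mul, abs_of_nonneg hA]
    exact mul_le_of_le_one_right hA (Real.abs_sin_le_one _)

/-! ### Joint smoothness -/

/-- Functions of time and space that are smooth in space, with derivatives that are locally
bounded, and continuous in time. -/
structure SpaceSmooth (s : Set ℝ) (u : ℝ → ℝ → ℝ) : Prop where
  smooth : ∀ t ∈ s, SmoothBdd (u t)
  bdd : ∀ k, ∀ t ∈ s, ∃ D, ∀ᶠ r in 𝓝 t, ∀ x, |iteratedDeriv k (u r) x| ≤ D
  cont : ∀ k x, ContinuousOn (fun t => iteratedDeriv k (u t) x) s

/-- Functions with `n` successive time derivatives that are smooth in space. -/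
def TimeSmooth (s : Set ℝ) : ℕ → (ℝ → ℝ → ℝ) → Prop
  | 0, u => SpaceSmooth s u
  | n + 1, u => SpaceSmooth s u ∧
      ∃ v, TimeSmooth s n v ∧ ∀ t ∈ s, ∀ x, HasDerivAt (fun r => u r x) (v t x) t

namespace SpaceSmooth

variable {s : Set ℝ} {u v w : ℝ → ℝ → ℝ}

lemma bdd_zero (hu : SpaceSmooth s u) {t : ℝ} (ht : t ∈ s) :
    ∃ D, ∀ᶠ r in 𝓝 t, ∀ x, |u r x| ≤ D := by simpa using hu.bdd 0 t ht

lemma eventually_lipschitz (hs : IsOpen s) (hu : SpaceSmooth s u) {t : ℝ} (ht : t ∈ s) :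
    ∃ D, ∀ᶠ r in 𝓝 t, ∀ x y, |u r x - u r y| ≤ D * |x - y| := by
  obtain ⟨D, hD⟩ := hu.bdd 1 t ht
  refine ⟨D, ?_⟩
  filter_upwards [hD, hs.mem_nhds ht] with r hr hrs
  simpa using (hu.smooth r hrs).lipschitz_iteratedDeriv (k := 0) hr

lemma iteratedDeriv_iteratedDeriv (f : ℝ → ℝ) (j k : ℕ) :
    iteratedDeriv j (iteratedDeriv k f) = iteratedDeriv (j + k) f := by
  simp only [iteratedDeriv_eq_iterate, Function.iterate_add_apply]

lemma iteratedDeriv (hu : SpaceSmooth s u) (k : ℕ) :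
    SpaceSmooth s fun t => iteratedDeriv k (u t) where
  smooth t ht := (hu.smooth t ht).iteratedDeriv k
  bdd j t ht := by simpa only [iteratedDeriv_iteratedDeriv] using hu.bdd (j + k) t ht
  cont j x := by simpa only [iteratedDeriv_iteratedDeriv] using hu.cont (j + k) x

lemma deriv (hu : SpaceSmooth s u) : SpaceSmooth s fun t => deriv (u t) := by
  simpa only [iteratedDeriv_one] using hu.iteratedDeriv 1

lemma continuousOn (hu : SpaceSmooth s u) (x : ℝ) : ContinuousOn (fun t => u t x) s := by
  simpa using hu.cont 0 x

lemma add (hs : IsOpen s) (hu : SpaceSmooth s u) (hw : SpaceSmooth s w) :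
    SpaceSmooth s fun t x => u t x + w t x where
  smooth t ht := (hu.smooth t ht).add (hw.smooth t ht)
  bdd k t ht := by
    obtain ⟨D, hD⟩ := hu.bdd k t ht
    obtain ⟨E, hE⟩ := hw.bdd k t ht
    refine ⟨D + E, ?_⟩
    filter_upwards [hD, hE, hs.mem_nhds ht] with r h1 h2 hr x
    rw [(hu.smooth r hr).iteratedDeriv_add (hw.smooth r hr)]
    exact (abs_add_le _ _).trans (add_le_add (h1 x) (h2 x))
  cont k x := ((hu.cont k x).add (hw.cont k x)).congr fun t ht =>
    (hu.smooth t ht).iteratedDeriv_add (hw.smooth t ht) k x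

lemma neg (hu : SpaceSmooth s u) : SpaceSmooth s fun t x => -u t x where
  smooth t ht := by simpa using (hu.smooth t ht).const_mul (-1)
  bdd k t ht := by simpa [iteratedDeriv_fun_neg] using hu.bdd k t ht
  cont k x := by simpa only [iteratedDeriv_fun_neg] using (hu.cont k x).fun_neg

lemma mul (hs : IsOpen s) (hu : SpaceSmooth s u) (hw : SpaceSmooth s w) :
    SpaceSmooth s fun t x => u t x * w t x where
  smooth t ht := (hu.smooth t ht).mul (hw.smooth t ht)
  bdd k t ht := by
    choose D hD using fun k => hu.bdd k t ht
    choose E hE using fun k => hw.bdd k t ht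
    refine ⟨∑ i ∈ Finset.range (k + 1), (k.choose i : ℝ) * D i * E (k - i), ?_⟩
    have h1 : ∀ᶠ r in 𝓝 t, ∀ i ∈ Finset.range (k + 1), ∀ x, |_root_.iteratedDeriv i (u r) x| ≤ D i :=
      (Filter.eventually_all_finset _).2 fun i _ => hD i
    have h2 : ∀ᶠ r in 𝓝 t, ∀ i ∈ Finset.range (k + 1),
        ∀ x, |_root_.iteratedDeriv (k - i) (w r) x| ≤ E (k - i) :=
      (Filter.eventually_all_finset _).2 fun i _ => hE (k - i)
    filter_upwards [h1, h2, hs.mem_nhds ht] with r h1 h2 hr x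
    rw [(hu.smooth r hr).iteratedDeriv_mul (hw.smooth r hr)]
    refine (Finset.abs_sum_le_sum_abs _ _).trans (Finset.sum_le_sum fun i hi => ?_)
    rw [abs_mul, abs_mul, Nat.abs_cast]
    have := (abs_nonneg _).trans (h1 i hi x)
    gcongr
    · exact h1 i hi x
    · exact h2 i hi x
  cont k x := by
    refine ContinuousOn.congr ?_ fun t ht =>
      (hu.smooth t ht).iteratedDeriv_mul (hw.smooth t ht) k x
    exact continuousOn_finsetSum _ fun i _ =>
      (continuousOn_const.mul (hu.cont i x)).mul (hw.cont (k - i) x)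

lemma continuousAt_Lop {g : ℝ → ℝ} (hg : LevyKernel g) (hs : IsOpen s) (hu : SpaceSmooth s u)
    {t : ℝ} (ht : t ∈ s) (x : ℝ) : ContinuousAt (fun r => Lop g (u r) x) t := by
  obtain ⟨D, hD⟩ := hu.bdd_zero ht
  obtain ⟨E, hE⟩ := hu.eventually_lipschitz hs ht
  refine continuousAt_of_dominated (bound := fun y => (2 * D + E) * (min 1 |y| * g y)) ?_ ?_
    (hg.int.const_mul _) (ae_of_all _ fun y => ?_)
  · filter_upwards [hD, hE, hs.mem_nhds ht] with r h1 h2 hr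
    exact (hg.integrable (hu.smooth r hr).continuous h1 h2 x).1
  · filter_upwards [hD, hE] with r h1 h2
    refine ae_of_all _ fun y => ?_
    rw [Real.norm_eq_abs, abs_mul, abs_of_nonneg (hg.nonneg y), ← mul_assoc]
    exact mul_le_mul_of_nonneg_right (abs_sub_add_le_min h1 h2 x y) (hg.nonneg y)
  · have h1 := (hu.continuousOn x).continuousAt (hs.mem_nhds ht)
    have h2 := (hu.continuousOn (x + y)).continuousAt (hs.mem_nhds ht)
    exact (h1.sub h2).mul continuousAt_const

lemma Lop {g : ℝ → ℝ} (hg : LevyKernel g) (hs : IsOpen s) (hu : SpaceSmooth s u) :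
    SpaceSmooth s fun t => Lop g (u t) where
  smooth t ht := (hu.smooth t ht).Lop hg
  bdd k t ht := by
    obtain ⟨D, hD⟩ := (hu.iteratedDeriv k).bdd_zero ht
    obtain ⟨E, hE⟩ := (hu.iteratedDeriv k).eventually_lipschitz hs ht
    refine ⟨(2 * D + E) * kernelMass g, ?_⟩
    filter_upwards [hD, hE, hs.mem_nhds ht] with r h1 h2 hr
    rw [(hu.smooth r hr).iteratedDeriv_Lop hg]
    exact hg.abs_Lop_le h1 h2
  cont k x := by
    refine ContinuousOn.congr (f := fun t => _root_.Lop g (_root_.iteratedDeriv k (u t)) x)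
      (fun t ht => ((hu.iteratedDeriv k).continuousAt_Lop hg hs ht x).continuousWithinAt)
      fun t ht => ?_
    simp only
    rw [(hu.smooth t ht).iteratedDeriv_Lop hg]

lemma continuousOn_uncurry (hs : IsOpen s) (hu : SpaceSmooth s u) :
    ContinuousOn (fun p : ℝ × ℝ => u p.1 p.2) (s ×ˢ univ) := by
  rintro ⟨t, x⟩ ⟨ht, -⟩
  refine ContinuousAt.continuousWithinAt ?_
  obtain ⟨E, hE⟩ := hu.eventually_lipschitz hs ht
  have h1 : Tendsto (fun p : ℝ × ℝ => u p.1 p.2 - u p.1 x) (𝓝 (t, x)) (𝓝 0) := by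
    refine squeeze_zero_norm' (a := fun p : ℝ × ℝ => E * |p.2 - x|) ?_ ?_
    · filter_upwards [(continuous_fst.tendsto (t, x)).eventually hE] with p hp
      exact hp p.2 x
    · have : Continuous fun p : ℝ × ℝ => E * |p.2 - x| := by fun_prop
      simpa using this.tendsto (t, x)
  have h2 : Tendsto (fun p : ℝ × ℝ => u p.1 x) (𝓝 (t, x)) (𝓝 (u t x)) :=
    ((hu.continuousOn x).continuousAt (hs.mem_nhds ht)).tendsto.comp
      (continuous_fst.tendsto (t, x))
  have := h1.add h2
  simpa [ContinuousAt] using this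

/-- Time and space derivatives commute. -/
lemma hasDerivAt_deriv (hs : IsOpen s) (hu : SpaceSmooth s u) (hv : SpaceSmooth s v)
    (h : ∀ t ∈ s, ∀ x, HasDerivAt (fun r => u r x) (v t x) t) {t : ℝ} (ht : t ∈ s) (x : ℝ) :
    HasDerivAt (fun r => _root_.deriv (u r) x) (_root_.deriv (v t) x) t := by
  obtain ⟨D, hD⟩ := hv.deriv.bdd_zero ht
  obtain ⟨ε, hε, hball⟩ := Metric.eventually_nhds_iff_ball.1 (hD.and (hs.mem_nhds ht))
  have sub : ∀ r ∈ Metric.ball t ε, uIcc t r ⊆ Metric.ball t ε := fun r hr =>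
    (convex_ball t ε).ordConnected.uIcc_subset (Metric.mem_ball_self hε) hr
  have subs : ∀ r ∈ Metric.ball t ε, uIcc t r ⊆ s := fun r hr q hq => (hball q (sub r hr hq)).2
  have ii : ∀ r ∈ Metric.ball t ε, ∀ y, IntervalIntegrable (fun q => v q y) volume t r :=
    fun r hr y => ((hv.continuousOn y).mono (subs r hr)).intervalIntegrable
  have ii' : ∀ r ∈ Metric.ball t ε, ∀ y,
      IntervalIntegrable (fun q => _root_.deriv (v q) y) volume t r :=
    fun r hr y => ((hv.deriv.continuousOn y).mono (subs r hr)).intervalIntegrable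
  have ftc : ∀ r ∈ Metric.ball t ε, ∀ y, u r y - u t y = ∫ q in t..r, v q y := fun r hr y =>
    (intervalIntegral.integral_eq_sub_of_hasDerivAt (fun q hq => h q (subs r hr hq) y)
      (ii r hr y)).symm
  have dx : ∀ r ∈ Metric.ball t ε, _root_.deriv (u r) x =
      _root_.deriv (u t) x + ∫ q in t..r, _root_.deriv (v q) x := by
    intro r hr
    have h1 := (intervalIntegral.hasDerivAt_integral_of_dominated_loc_of_deriv_le
      (F := fun y q => v q y) (F' := fun y q => _root_.deriv (v q) y) (x₀ := x) (a := t) (b := r)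
      (bound := fun _ => D) (s := univ) (μ := volume) univ_mem
      (Eventually.of_forall fun y => (ii r hr y).aestronglyMeasurable_restrict_uIoc) (ii r hr x)
      (ii' r hr x).aestronglyMeasurable_restrict_uIoc
      (ae_of_all _ fun q hq y _ => (hball q (sub r hr (uIoc_subset_uIcc hq))).1 y)
      intervalIntegrable_const
      (ae_of_all _ fun q hq y _ =>
        (hv.smooth q (subs r hr (uIoc_subset_uIcc hq))).hasDerivAt y)).2
    have h2 := (hu.smooth r (hball r hr).2).hasDerivAt x
    have h3 := (hu.smooth t ht).hasDerivAt x
    have h4 := (h2.sub h3)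
    have h5 : (u r - u t) = fun y => ∫ q in t..r, v q y := funext fun y => ftc r hr y
    rw [h5] at h4
    have := h4.unique h1
    linarith
  have hev : (fun r => _root_.deriv (u r) x) =ᶠ[𝓝 t]
      fun r => _root_.deriv (u t) x + ∫ q in t..r, _root_.deriv (v q) x := by
    filter_upwards [Metric.ball_mem_nhds t hε] with r hr using dx r hr
  refine HasDerivAt.congr_of_eventuallyEq ?_ hev
  refine HasDerivAt.const_add _ (intervalIntegral.integral_hasDerivAt_right ?_ ?_ ?_)
  · simp
  · exact (hv.deriv.continuousOn x).stronglyMeasurableAtFilter hs t ht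
  · exact (hv.deriv.continuousOn x).continuousAt (hs.mem_nhds ht)

/-- The time derivative passes through the nonlocal operator. -/
lemma hasDerivAt_Lop {g : ℝ → ℝ} (hg : LevyKernel g) (hs : IsOpen s) (hu : SpaceSmooth s u)
    (hv : SpaceSmooth s v) (h : ∀ t ∈ s, ∀ x, HasDerivAt (fun r => u r x) (v t x) t) {t : ℝ}
    (ht : t ∈ s) (x : ℝ) : HasDerivAt (fun r => _root_.Lop g (u r) x) (_root_.Lop g (v t) x) t := by
  obtain ⟨D, hD⟩ := hv.bdd_zero ht
  obtain ⟨E, hE⟩ := hv.eventually_lipschitz hs ht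
  have hev := (hD.and hE).and (hs.mem_nhds ht)
  have int : ∀ {w : ℝ → ℝ → ℝ}, SpaceSmooth s w → ∀ r ∈ s,
      Integrable (fun y => (w r x - w r (x + y)) * g y) := fun {w} hw r hr => by
    obtain ⟨B₀, h0⟩ := (hw.smooth r hr).bdd_zero
    obtain ⟨B₁, h1⟩ := (hw.smooth r hr).lipschitz
    exact hg.integrable (hw.smooth r hr).continuous h0 h1 x
  refine (hasDerivAt_integral_of_dominated_loc_of_deriv_le
    (F := fun r y => (u r x - u r (x + y)) * g y) (F' := fun r y => (v r x - v r (x + y)) * g y)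
    (bound := fun y => (2 * D + E) * (min 1 |y| * g y)) hev ?_ (int hu t ht) (int hv t ht).1
    (ae_of_all _ fun y r hr => ?_) (hg.int.const_mul _) (ae_of_all _ fun y r hr => ?_)).2
  · filter_upwards [hs.mem_nhds ht] with r hr using (int hu r hr).1
  · rw [Real.norm_eq_abs, abs_mul, abs_of_nonneg (hg.nonneg y), ← mul_assoc]
    exact mul_le_mul_of_nonneg_right (abs_sub_add_le_min hr.1.1 hr.1.2 x y) (hg.nonneg y)
  · exact ((h r hr.2 x).sub (h r hr.2 (x + y))).mul_const (g y)

end SpaceSmooth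

namespace TimeSmooth

variable {s : Set ℝ} {u v w : ℝ → ℝ → ℝ} {n : ℕ}

lemma spaceSmooth (hu : TimeSmooth s n u) : SpaceSmooth s u := by
  cases n with
  | zero => exact hu
  | succ n => exact hu.1

lemma of_succ (hu : TimeSmooth s (n + 1) u) : TimeSmooth s n u := by
  induction n generalizing u with
  | zero => exact hu.1
  | succ n ih =>
    obtain ⟨h, v, hv, hd⟩ := hu
    exact ⟨h, v, ih hv, hd⟩

lemma add (hs : IsOpen s) (hu : TimeSmooth s n u) (hw : TimeSmooth s n w) :
    TimeSmooth s n fun t x => u t x + w t x := by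
  induction n generalizing u w with
  | zero => exact SpaceSmooth.add hs hu hw
  | succ n ih =>
    obtain ⟨h, v, hv, hd⟩ := hu
    obtain ⟨h', z, hz, hd'⟩ := hw
    exact ⟨h.add hs h', _, ih hv hz, fun t ht x => (hd t ht x).add (hd' t ht x)⟩

lemma neg (hu : TimeSmooth s n u) : TimeSmooth s n fun t x => -u t x := by
  induction n generalizing u with
  | zero => exact SpaceSmooth.neg hu
  | succ n ih =>
    obtain ⟨h, v, hv, hd⟩ := hu
    exact ⟨h.neg, _, ih hv, fun t ht x => (hd t ht x).neg⟩

lemma mul (hs : IsOpen s) (hu : TimeSmooth s n u) (hw : TimeSmooth s n w) :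
    TimeSmooth s n fun t x => u t x * w t x := by
  induction n generalizing u w with
  | zero => exact SpaceSmooth.mul hs hu hw
  | succ n ih =>
    -- Leibniz' rule pairs a time derivative, of level n, with an undifferentiated factor, which
    -- must be lowered from level n + 1 to n before the induction hypothesis applies.
    have hu0 := hu.of_succ
    have hw0 := hw.of_succ
    obtain ⟨h, v, hv, hd⟩ := hu
    obtain ⟨h', z, hz, hd'⟩ := hw
    exact ⟨h.mul hs h', _, (ih hv hw0).add hs (ih hu0 hz),
      fun t ht x => (hd t ht x).mul (hd' t ht x)⟩

lemma deriv (hs : IsOpen s) (hu : TimeSmooth s n u) : TimeSmooth s n fun t => deriv (u t) := by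
  induction n generalizing u with
  | zero => exact SpaceSmooth.deriv hu
  | succ n ih =>
    obtain ⟨h, v, hv, hd⟩ := hu
    exact ⟨h.deriv, _, ih hv, fun t ht x => h.hasDerivAt_deriv hs hv.spaceSmooth hd ht x⟩

lemma Lop {g : ℝ → ℝ} (hg : LevyKernel g) (hs : IsOpen s) (hu : TimeSmooth s n u) :
    TimeSmooth s n fun t => Lop g (u t) := by
  induction n generalizing u with
  | zero => exact SpaceSmooth.Lop hg hs hu
  | succ n ih =>
    obtain ⟨h, v, hv, hd⟩ := hu
    exact ⟨h.Lop hg hs, _, ih hv, fun t ht x => h.hasDerivAt_Lop hg hs hv.spaceSmooth hd ht x⟩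

lemma burgersRate {g : ℝ → ℝ} (hg : LevyKernel g) (hs : IsOpen s) (hu : TimeSmooth s n u) :
    TimeSmooth s n fun t => burgersRate g (u t) := by
  have := (hu.mul hs (hu.deriv hs)).add hs (hu.Lop hg hs).neg
  simp only [← sub_eq_add_neg] at this
  exact this

/-- Both partial derivatives are jointly continuous and again of level n, so they assemble into a
Fréchet derivative of class Cⁿ by induction. -/
lemma contDiffOn (hs : IsOpen s) (hu : TimeSmooth s n u) :
    ContDiffOn ℝ n (fun p : ℝ × ℝ => u p.1 p.2) (s ×ˢ univ) := by
  induction n generalizing u with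
  | zero =>
    rw [Nat.cast_zero, contDiffOn_zero]
    exact SpaceSmooth.continuousOn_uncurry hs hu
  | succ n ih =>
    have hd := hu.of_succ.deriv hs
    obtain ⟨h, v, hv, hdt⟩ := hu
    have ho : IsOpen (s ×ˢ (univ : Set ℝ)) := hs.prod isOpen_univ
    have cv := hv.spaceSmooth.continuousOn_uncurry hs
    have cd := h.deriv.continuousOn_uncurry hs
    let L : ℝ →L[ℝ] (ℝ →L[ℝ] ℝ) := ContinuousLinearMap.toSpanSingletonCLE.toContinuousLinearMap
    have hF : ∀ p ∈ s ×ˢ (univ : Set ℝ), HasFDerivAt (fun p : ℝ × ℝ => u p.1 p.2)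
        ((L (v p.1 p.2)).coprod (L (_root_.deriv (u p.1) p.2))) p := by
      rintro p hp
      have ev : ∀ᶠ q in 𝓝 p, q ∈ s ×ˢ (univ : Set ℝ) := ho.mem_nhds hp
      exact (hasStrictFDerivAt_uncurry_coprod (f := u) (f₁ := fun t x => L (v t x))
        (f₂ := fun t x => L (_root_.deriv (u t) x))
        (ev.mono fun q hq => (hdt q.1 hq.1 q.2).hasFDerivAt)
        (ev.mono fun q hq => ((h.smooth q.1 hq.1).hasDerivAt q.2).hasFDerivAt)
        (L.continuous.continuousAt.comp (cv.continuousAt ev))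
        (L.continuous.continuousAt.comp (cd.continuousAt ev))).hasFDerivAt
    rw [Nat.cast_succ, contDiffOn_succ_iff_hasFDerivWithinAt_of_uniqueDiffOn ho.uniqueDiffOn]
    refine ⟨by simp, _, ?_, fun p hp => (hF p hp).hasFDerivWithinAt⟩
    have e : ∀ a b : ℝ, (L a).coprod (L b) = (L a).comp (ContinuousLinearMap.fst ℝ ℝ ℝ) +
        (L b).comp (ContinuousLinearMap.snd ℝ ℝ ℝ) := fun a b => by
      ext <;> simp
    simp only [e]
    exact ((L.contDiff.comp_contDiffOn (ih hv)).clm_comp contDiffOn_const).add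
      ((L.contDiff.comp_contDiffOn (ih hd)).clm_comp contDiffOn_const)

end TimeSmooth

/-- A solution of the equation that is smooth in space is smooth. -/
lemma SpaceSmooth.timeSmooth {g : ℝ → ℝ} (hg : LevyKernel g) {s : Set ℝ} (hs : IsOpen s)
    {u : ℝ → ℝ → ℝ} (hu : SpaceSmooth s u)
    (h : ∀ t ∈ s, ∀ x, HasDerivAt (fun r => u r x) (burgersRate g (u t) x) t) (n : ℕ) :
    TimeSmooth s n u := by
  induction n with
  | zero => exact hu
  | succ n ih => exact ⟨hu, _, ih.burgersRate hg hs, h⟩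

/-! ### Profiles as Lévy kernels -/

namespace IsDissipationProfile

variable {m : ℝ → ℝ} (hm : IsDissipationProfile m)
include hm

/-- Since m is nonnegative, the convergent integrals over (ε,1) are also bounds for the integrals of
|m|, which gives integrability up to 0. -/
lemma integrableOn_Ioc (hint : ∃ A : ℝ, Tendsto (fun ε : ℝ => ∫ r in ε..1, m r) (𝓝[>] 0) (𝓝 A)) :
    IntegrableOn m (Ioc 0 1) := by
  obtain ⟨A, hA⟩ := hint
  have hlim : Tendsto (fun n : ℕ => 1 / ((n : ℝ) + 1)) atTop (𝓝 0) :=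
    tendsto_one_div_add_atTop_nhds_zero_nat
  have hpos : ∀ n : ℕ, 0 < 1 / ((n : ℝ) + 1) := fun n => by positivity
  have hlim' : Tendsto (fun n : ℕ => 1 / ((n : ℝ) + 1)) atTop (𝓝[>] 0) :=
    tendsto_nhdsWithin_iff.2 ⟨hlim, Eventually.of_forall hpos⟩
  refine integrableOn_Ioc_of_intervalIntegral_norm_bounded_left (I := A + 1) (l := atTop)
    (a := fun n : ℕ => 1 / ((n : ℝ) + 1)) (fun n => ?_) hlim ?_
  · exact ((hm.smooth.continuousOn.mono fun x hx => (hpos n).trans_le hx.1).integrableOn_Icc).mono_set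
      Ioc_subset_Icc_self
  · filter_upwards [(hA.comp hlim').eventually (gt_mem_nhds (lt_add_one A))] with n hn
    have h1 : 1 / ((n : ℝ) + 1) ≤ 1 := by
      rw [div_le_one (by positivity)]
      linarith [Nat.cast_nonneg (α := ℝ) n]
    have : ∫ x in Ioc (1 / ((n : ℝ) + 1)) 1, ‖m x‖ = ∫ x in (1 / ((n : ℝ) + 1))..1, m x := by
      rw [intervalIntegral.integral_of_le h1]
      refine setIntegral_congr_fun measurableSet_Ioc fun x hx => ?_
      exact Real.norm_of_nonneg (hm.nonneg x ((hpos n).trans hx.1))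
    rw [this]
    exact hn.le

/-- Monotonicity of r^α m(r) gives m(r) ≤ m(1) r^(-α) for r > 1, so m(r)/r is dominated by an
integrable power. -/
lemma integrableOn_Ioi : IntegrableOn (fun r => m r / r) (Ioi 1) := by
  obtain ⟨α, hα, hdec⟩ := hm.decay
  have hdom : IntegrableOn (fun r : ℝ => m 1 * r ^ (-α - 1)) (Ioi 1) :=
    ((integrableOn_Ioi_rpow_iff one_pos).2 (by linarith)).const_mul _
  refine hdom.mono' ?_ ((ae_restrict_iff' measurableSet_Ioi).2 (ae_of_all _ fun r hr => ?_))
  · refine ContinuousOn.aestronglyMeasurable ?_ measurableSet_Ioi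
    exact (hm.smooth.continuousOn.mono fun x hx => one_pos.trans hx).div continuousOn_id
      fun x hx => (one_pos.trans hx).ne'
  · have hr1 : (1 : ℝ) < r := hr
    have hr0 : 0 < r := one_pos.trans hr1
    rw [Real.norm_of_nonneg (div_nonneg (hm.nonneg r hr0) hr0.le), Real.rpow_sub hr0,
      Real.rpow_one, ← mul_div_assoc, Real.rpow_neg hr0.le]
    have h1 := hdec (mem_Ioi.2 one_pos) (mem_Ioi.2 hr0) hr1.le
    simp only [Real.one_rpow, one_mul] at h1
    have h2 := Real.rpow_pos_of_pos hr0 α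
    refine div_le_div_of_nonneg_right ?_ hr0.le
    rw [← div_eq_mul_inv, le_div_iff₀ h2]
    linarith

lemma levyKernel (hint : ∃ A : ℝ, Tendsto (fun ε : ℝ => ∫ r in ε..1, m r) (𝓝[>] 0) (𝓝 A)) :
    LevyKernel (fun y => m |y| / |y|) where
  nonneg y := by
    rcases eq_or_ne y 0 with rfl | hy
    · simp
    · exact div_nonneg (hm.nonneg _ (abs_pos.2 hy)) (abs_nonneg y)
  even y := by simp
  meas := by
    have h : ContinuousOn (fun y : ℝ => m |y| / |y|) {0}ᶜ := by
      refine ContinuousOn.div ?_ continuous_abs.continuousOn fun y hy => abs_ne_zero.2 hy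
      exact hm.smooth.continuousOn.comp continuous_abs.continuousOn fun y hy => abs_pos.2 hy
    have := h.aestronglyMeasurable (μ := volume) (measurableSet_singleton 0).compl
    rwa [restrict_compl_singleton] at this
  int := by
    have h1 : IntegrableOn (fun r => min 1 r * (m r / r)) (Ioi 0) := by
      rw [← Ioc_union_Ioi_eq_Ioi zero_le_one]
      refine IntegrableOn.union ?_ ?_
      · refine (hm.integrableOn_Ioc hint).congr_fun (fun r hr => ?_) measurableSet_Ioc
        have := hr.1.ne'
        simp only [min_eq_right hr.2]
        field_simp
      · refine hm.integrableOn_Ioi.congr_fun (fun r hr => ?_) measurableSet_Ioi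
        rw [min_eq_left (le_of_lt hr), one_mul]
    have h2 : IntegrableOn (fun y => min 1 |y| * (m |y| / |y|)) (Ioi 0) :=
      h1.congr_fun (fun r hr => by simp only [abs_of_pos (mem_Ioi.1 hr)]) measurableSet_Ioi
    have h3 : IntegrableOn (fun y => min 1 |y| * (m |y| / |y|)) (Iio 0) := by
      have := (Measure.measurePreserving_neg (volume : Measure ℝ)).integrableOn_comp_preimage
        (Homeomorph.neg ℝ).measurableEmbedding |>.2 h2
      simpa [Function.comp_def] using this
    rw [← integrableOn_univ, ← Iic_union_Ioi (a := (0 : ℝ))]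
    exact ((integrableOn_Iic_iff_integrableOn_Iio).2 h3).union h2

end IsDissipationProfile

/-- The integrand is absolutely integrable over the whole line, so the principal value is an
ordinary integral by dominated convergence. -/
lemma LevyKernel.hasDissipation {m : ℝ → ℝ} (hg : LevyKernel (fun y => m |y| / |y|)) {f : ℝ → ℝ}
    (hf : SmoothBdd f) (x : ℝ) : HasDissipation m f x (Lop (fun y => m |y| / |y|) f x) := by
  obtain ⟨B₀, h0⟩ := hf.bdd_zero
  obtain ⟨B₁, h1⟩ := hf.lipschitz
  have hi := hg.integrable hf.continuous h0 h1 x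
  refine ⟨fun ε _ => hi.integrableOn, ?_⟩
  simp only [← integral_indicator (measurableSet_lt_abs _)]
  refine tendsto_integral_filter_of_dominated_convergence
    (fun y => ‖(f x - f (x + y)) * (m |y| / |y|)‖)
    (Eventually.of_forall fun ε => hi.1.indicator (measurableSet_lt_abs ε))
    (Eventually.of_forall fun ε => ae_of_all _ fun y => norm_indicator_le_norm_self _ _)
    hi.norm (ae_of_all _ fun y => ?_)
  rcases eq_or_ne y 0 with rfl | hy
  · simp [indicator]
  · refine tendsto_const_nhds.congr' ?_
    filter_upwards [nhdsWithin_le_nhds (gt_mem_nhds (abs_pos.2 hy))] with ε hε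
    rw [indicator_of_mem (show y ∈ {y : ℝ | ε < |y|} from hε)]

/-! ### The maximal solution -/

/-- For r < t the estimate is expanded from the base point r, and continuity of `q` allows `q r` to
be replaced by `q t`. A forward estimate thus gives a two-sided derivative. -/
lemma hasDerivAt_of_forward_quadratic {p q : ℝ → ℝ} {C t : ℝ} {s : Set ℝ} (hs : s ∈ 𝓝 t)
    (hq : ContinuousAt q t)
    (h : ∀ a ∈ s, ∀ b ∈ s, a ≤ b → |p b - p a - (b - a) * q a| ≤ C * (b - a) ^ 2) :
    HasDerivAt p (q t) t := by
  rw [hasDerivAt_iff_isLittleO, Asymptotics.isLittleO_iff]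
  intro ε hε
  have h1 : ∀ᶠ r in 𝓝 t, C * |r - t| < ε / 2 := by
    have : Continuous fun r => C * |r - t| := by fun_prop
    exact this.continuousAt.eventually_lt continuousAt_const (by simpa using half_pos hε)
  have h2 : ∀ᶠ r in 𝓝 t, |q t - q r| < ε / 2 := by
    have : ContinuousAt (fun r => |q t - q r|) t := (continuousAt_const.sub hq).abs
    exact this.eventually_lt continuousAt_const (by simpa using half_pos hε)
  filter_upwards [h1, h2, hs] with r e1 e2 hr
  rw [Real.norm_eq_abs, Real.norm_eq_abs, smul_eq_mul]
  have e3 : C * (r - t) ^ 2 ≤ ε / 2 * |r - t| := by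
    rw [← sq_abs, sq, ← mul_assoc]
    exact mul_le_mul_of_nonneg_right e1.le (abs_nonneg _)
  rcases le_total t r with htr | htr
  · have := h t (mem_of_mem_nhds hs) r hr htr
    nlinarith [abs_nonneg (r - t)]
  · have e4 := h r hr t (mem_of_mem_nhds hs) htr
    rw [show p r - p t - (r - t) * q t =
      -(p t - p r - (t - r) * q r) + (t - r) * (q t - q r) by ring]
    refine (abs_add_le _ _).trans ?_
    rw [abs_neg, abs_mul, abs_sub_comm t r]
    have e5 : |r - t| * |q t - q r| ≤ |r - t| * (ε / 2) :=
      mul_le_mul_of_nonneg_left e2.le (abs_nonneg _)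
    have e6 : C * (t - r) ^ 2 = C * (r - t) ^ 2 := by ring
    linarith

/-- A pointwise bound from a bound on the essential supremum. -/
lemma abs_le_of_eLpNorm_top_le {f : ℝ → ℝ} (hf : Continuous f) {M : NNReal}
    (h : eLpNorm f ⊤ volume ≤ M) (x : ℝ) : |f x| ≤ M := by
  by_contra hx
  have ho : IsOpen {y | (M : ℝ) < |f y|} := isOpen_lt continuous_const hf.abs
  have hae : ∀ᵐ y, ‖f y‖ₑ ≤ M := by
    rw [eLpNorm_exponent_top] at h
    filter_upwards [ae_le_eLpNormEssSup (f := f) (μ := volume)] with y hy using hy.trans h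
  have hz : volume {y | (M : ℝ) < |f y|} = 0 := by
    refine measure_mono_null (fun y hy => ?_) (ae_iff.1 hae)
    have hy : (M : ℝ) < ‖f y‖ := hy
    have : (M : ENNReal) < ‖f y‖ₑ := by
      rw [enorm_eq_nnnorm]
      exact_mod_cast hy
    exact not_le.2 this
  rw [ho.measure_eq_zero_iff (μ := volume)] at hz
  exact (eq_empty_iff_forall_notMem.1 hz x) (not_le.1 hx)

namespace OddDatum

variable {g : ℝ → ℝ} {K ℓ : ℝ} {f : ℝ → ℝ} (hd : OddDatum g K ℓ f)
include hd

lemma spaceSmooth_burgersLimit {S : ℝ} (hS : ∀ t < S, SlopeControlled g K f t) :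
    SpaceSmooth (Ioo 0 S) (burgersLimit g K f) where
  smooth t ht := (hd.smooth_burgersLimit (hS t ht.2) ⟨ht.1.le, le_rfl⟩).1
  bdd k t ht := by
    obtain ⟨T, htT, hTS⟩ := exists_between ht.2
    obtain ⟨D, hD⟩ := hd.bdd_burgersLimit (hS T hTS) k
    exact ⟨D, by filter_upwards [Icc_mem_nhds ht.1 htT] with r hr using hD r hr⟩
  cont k x t ht := by
    obtain ⟨T, htT, hTS⟩ := exists_between ht.2
    obtain ⟨C, hC0, hC⟩ := hd.lipschitz_burgersLimit (hS T hTS) k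
    have : LipschitzOnWith (Real.toNNReal C) (fun t => iteratedDeriv k (burgersLimit g K f t) x)
        (Icc 0 T) := by
      refine LipschitzOnWith.of_dist_le_mul fun r hr s hs => ?_
      rw [Real.coe_toNNReal _ hC0, Real.dist_eq, Real.dist_eq]
      rcases le_total s r with h | h
      · rw [abs_of_nonneg (sub_nonneg.2 h)]; exact hC s hs r hr h x
      · rw [abs_sub_comm, abs_sub_comm r, abs_of_nonneg (sub_nonneg.2 h)]
        exact hC r hr s hs h x
    exact (this.continuousOn.continuousAt (Icc_mem_nhds ht.1 htT)).continuousWithinAt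

lemma hasDerivAt_burgersLimit {S : ℝ} (hS : ∀ t < S, SlopeControlled g K f t) {t : ℝ}
    (ht : t ∈ Ioo 0 S) (x : ℝ) : HasDerivAt (fun r => burgersLimit g K f r x)
      (burgersRate g (burgersLimit g K f t) x) t := by
  obtain ⟨T, htT, hTS⟩ := exists_between ht.2
  obtain ⟨C, hC⟩ := hd.burgersLimit_quadratic (hS T hTS)
  have hsp : TimeSmooth (Ioo 0 S) 0 (burgersLimit g K f) := hd.spaceSmooth_burgersLimit hS
  have hc := (hsp.burgersRate hd.levy isOpen_Ioo).spaceSmooth.continuousOn x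
  exact hasDerivAt_of_forward_quadratic (q := fun r => burgersRate g (burgersLimit g K f r) x)
    (Icc_mem_nhds ht.1 htT) (hc.continuousAt (isOpen_Ioo.mem_nhds ht))
    fun a ha b hb hab => hC a ha b hb hab x

end OddDatum

/-- A large odd datum leads to a smooth solution with gradient blow-up in finite time. -/
lemma exists_blowup_of_oddDatum {m : ℝ → ℝ} {K ℓ J : ℝ} {f : ℝ → ℝ}
    (hd : OddDatum (fun y => m |y| / |y|) K ℓ f)
    (hJ : J = ∫ x in (0 : ℝ)..ℓ, f x * (ℓ / 2 - x)) (hJ0 : 0 < J)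
    (hbig : ℓ * (1 + ℓ) * K * kernelMass (fun y => m |y| / |y|) + 1 <
      J ^ 2 / (2 * (ℓ ^ 3 / 12))) :
    ∃ θ₀ : ℝ → ℝ, ContDiff ℝ ∞ θ₀ ∧ Function.Periodic θ₀ ℓ ∧
      ∃ T : ℝ, 0 < T ∧ ∃ θ : ℝ → ℝ → ℝ, IsSmoothBurgersSolution m ℓ T θ₀ θ ∧
        Tendsto (fun t : ℝ => eLpNorm (deriv (θ t)) ⊤ volume) (𝓝[<] T) (𝓝 ⊤) := by
  set g : ℝ → ℝ := fun y => m |y| / |y| with hg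
  obtain ⟨T₀, hT₀, hcT₀⟩ := hd.exists_slopeControlled
  have hbdd : BddAbove {T | SlopeControlled g K f T} :=
    ⟨_, fun T hT => hd.le_of_slopeControlled hJ hJ0 hbig hT⟩
  -- The maximal time of slope control: positive by short-time control and finite by the moment
  -- argument. Control is known strictly before S.
  set S := sSup {T | SlopeControlled g K f T} with hSdef
  have hS0 : 0 < S := hT₀.trans_le (le_csSup hbdd hcT₀)
  have hS : ∀ t < S, SlopeControlled g K f t := fun t ht => by
    obtain ⟨T, hT, htT⟩ := exists_lt_of_lt_csSup ⟨T₀, hcT₀⟩ ht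
    exact SlopeControlled.mono hT htT.le
  set θ := burgersLimit g K f with hθ
  have sp := hd.spaceSmooth_burgersLimit hS
  have der := fun t ht => hd.hasDerivAt_burgersLimit hS (t := t) ht
  have sm : ContDiffOn ℝ ∞ (fun p : ℝ × ℝ => θ p.1 p.2) (Ioo 0 S ×ˢ univ) :=
    contDiffOn_infty.2 fun n => (sp.timeSmooth hd.levy isOpen_Ioo der n).contDiffOn isOpen_Ioo
  have mem : ∀ t ∈ Ico 0 (S / 2), t + S / 2 ∈ Ioo 0 S := fun t ht =>
    ⟨by linarith [ht.1], by linarith [ht.2]⟩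
  -- The limit is known to be jointly smooth on the open interval (0,S). Starting the clock at S/2
  -- makes the initial time an interior one, and the lifespan becomes S/2.
  refine ⟨θ (S / 2), (sp.smooth _ ⟨by linarith, by linarith⟩).smooth, hd.periodic_burgersLimit _,
    S / 2, half_pos hS0, fun t => θ (t + S / 2), ⟨?_, fun t _ => hd.periodic_burgersLimit _,
      fun x => by rw [zero_add], fun t ht x => ?_⟩, ?_⟩
  · refine sm.comp (f := fun p : ℝ × ℝ => (p.1 + S / 2, p.2)) (by fun_prop) ?_
    rintro p ⟨hp, -⟩
    exact ⟨mem _ hp, mem_univ _⟩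
  · refine ⟨burgersRate g (θ (t + S / 2)) x, Lop g (θ (t + S / 2)) x, ?_,
      hd.levy.hasDissipation (sp.smooth _ (mem t ht)) x, ?_⟩
    · exact ((der _ (mem t ht) x).comp_add_const t (S / 2)).hasDerivWithinAt
    · rw [burgersRate]; ring
  · rw [ENNReal.tendsto_nhds_top_iff_nnreal]
    intro M
    have hc : 0 < 1 / (16 * ((M : ℝ) + 1)) := by positivity
    have h1 : S / 2 - min (S / 2) (1 / (16 * ((M : ℝ) + 1))) < S / 2 := by
      have := lt_min (half_pos hS0) hc
      linarith
    filter_upwards [Ioo_mem_nhdsLT h1] with t ht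
    have h3 := min_le_left (S / 2) (1 / (16 * ((M : ℝ) + 1)))
    have h4 := min_le_right (S / 2) (1 / (16 * ((M : ℝ) + 1)))
    have ht0 : t ∈ Ico 0 (S / 2) := ⟨by linarith [ht.1], ht.2⟩
    have hmt := mem t ht0
    by_contra hle
    have hsl := abs_le_of_eLpNorm_top_le (sp.smooth _ hmt).deriv.continuous (not_lt.1 hle)
    -- A slope at most M at a time closer to S than 1/(16(M+1)) would prolong the control beyond S.
    have h2 := le_csSup hbdd (hd.slopeControlled_add hmt.1.le (hS _ hmt.2) hsl)
    linarith [ht.1]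

theorem theorem1p3 (m : ℝ → ℝ) (hm : IsDissipationProfile m)
    (C : ℝ) (hC : 1 ≤ C) (hmC : ∀ r : ℝ, 0 < r → r * |deriv m r| ≤ C * m r)
    (hint : ∃ A : ℝ, Tendsto (fun ε : ℝ => ∫ r in ε..1, m r) (𝓝[>] 0) (𝓝 A))
    (ℓ : ℝ) (hℓ : 0 < ℓ) :
    ∃ θ₀ : ℝ → ℝ, ContDiff ℝ ∞ θ₀ ∧ Function.Periodic θ₀ ℓ ∧
      ∃ T : ℝ, 0 < T ∧ ∃ θ : ℝ → ℝ → ℝ, IsSmoothBurgersSolution m ℓ T θ₀ θ ∧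
        Tendsto (fun t : ℝ => eLpNorm (deriv (θ t)) ⊤ volume) (𝓝[<] T) (𝓝 ⊤) := by
  have hg := hm.levyKernel hint
  set j := ℓ ^ 2 / (2 * Real.pi) with hj
  set D := ℓ * (1 + ℓ) * kernelMass (fun y => m |y| / |y|) with hD
  set c := j ^ 2 / (2 * (ℓ ^ 3 / 12)) with hc
  have hπ := Real.pi_pos
  have hj0 : 0 < j := by positivity
  have hc0 : 0 < c := by positivity
  have hD0 : 0 ≤ D := mul_nonneg (by positivity) hg.kernelMass_nonneg
  -- For amplitude A the moment is A·j, so the requirement reads A·D + 1 < A²c. This choice gives Ac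
  -- = D + 2 + c with A ≥ 1, which is enough.
  set A := (D + 2) / c + 1 with hA
  have hA1 : 1 ≤ A := by
    have : 0 ≤ (D + 2) / c := by positivity
    linarith
  have hAc : A * c = D + 2 + c := by rw [hA]; field_simp
  refine exists_blowup_of_oddDatum (oddDatum_sin hg hℓ (A := A) (by linarith))
    (integral_sin_mul hℓ A).symm (by positivity) ?_
  have e1 : (A * j) ^ 2 / (2 * (ℓ ^ 3 / 12)) = A * (A * c) := by rw [hc]; ring
  have e2 : ℓ * (1 + ℓ) * A * kernelMass (fun y => m |y| / |y|) = A * D := by rw [hD]; ring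
  rw [e1, e2, hAc]
  nlinarith
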